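/- Corollary. For positive integers $s$ and $n_1,\dots,n_s$, matrices $Q^{i,j}\in\mathbb Q^{n_i\times n_j}$ for $1\le i<j\le s$, and vectors $c^j\in\mathbb Q^{n_j}$ for $1\le j\le s$, consider the problem $$\text{(Q)}\qquad \max\ \sum_{1\le i<j\le s} (x^i)^{\mathsf T} Q^{i,j} x^j+\sum_{j=1}^s (c^j)^{\mathsf T} x^j\qquad\text{subject to } x^j\in\{0,1\}^{n_j}\ \ (j=1,\dots,s).$$ Problem (Q) can be solved in strongly polynomial time, provided that $s$ is fixed and the rank of each matrix $Q^{i,j}$, $i<j$, is fixed. That is, for every $s\ge 1$ and every $r\ge 0$ there are one program for a random access machine over the rationals (with unit-cost rational operations $+,-,\times,/$, comparisons, copying, loading of constants, direct and indirect addressing, and index registers holding natural numbers, with operations $+$, truncated $-$ and $\times$) and two polynomials $T$ and $S$ such that, for every instance of (Q) with $s$ blocks in which every $Q^{i,j}$, $i<j$, has rank at most $r$, the program, given the $n_j$, $Q^{i,j}$ and $c^j$, - halts after at most $T(N)$ steps, where $N=\sum_{i<j} n_in_j+\sum_j n_j$ is the number of rational numbers in the input, - never divides by zero, and produces only numbers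 of encoding length at most $S(L)$, where $L$ is the total encoding length of these $N$ rational numbers, and - outputs an optimal solution $(x^1,\dots,x^s)$ of (Q). Here the encoding length of a rational $p/q$ in lowest terms with $q>0$ is $1$ plus the binary lengths of $|p|$ and of $q$, and that of a natural number is its binary length. -/

import Mathlib

/-! ### Random access machine over the rationals

The memory consists of index registers, named by `ι`, that hold natural numbers (dimensions, loop
counters, addresses), and of arrays, named by `α`, that hold rational numbers. A program is a finite
term, so it mentions finitely many of these names, whatever the size of its input. Array cells are addressed directly or through an index register. Nothing flows from the rational
cells to the index registers except through comparisons. Every instruction and every test costs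
one step. -/

namespace RatRAM

/-- Encoding length of a rational number: one sign bit, and the binary lengths of the numerator
and of the denominator in lowest terms. -/
def ratSize (q : ℚ) : ℕ := 1 + Nat.size q.num.natAbs + Nat.size q.den

/-- Memory contents: index registers, and arrays of rational cells. -/
structure State (ι α : Type) where
  idx : ι → ℕ
  arr : α → ℕ → ℚ

/-- A rational memory cell: `direct a k` is cell number `k` of array `a`; `indirect a i` is the cell
of array `a` whose number is the content of the index register `i`. -/
inductive Ref (ι α : Type) where
  | direct (a : α) (k : ℕ)
  | indirect (a : α) (i : ι)

/-- Operations on index registers; `sub` is truncated subtraction. -/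
inductive IdxOp where
  | add
  | sub
  | mul

/-- The four arithmetic operations on rational cells. -/
inductive RatOp where
  | add
  | sub
  | mul
  | div

/-- Comparisons of two index registers, or of two rational cells. -/
inductive Test (ι α : Type) where
  | idxLt (i j : ι)
  | idxEq (i j : ι)
  | ratLt (x y : Ref ι α)
  | ratEq (x y : Ref ι α)

/-- Programs. -/
inductive Prog (ι α : Type) where
  | skip
  | idxConst (i : ι) (k : ℕ)
  | idxCopy (i j : ι)
  | idxArith (o : IdxOp) (i j k : ι)
  | ratConst (x : Ref ι α) (q : ℚ)
  | ratCopy (x y : Ref ι α)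
  | ratArith (o : RatOp) (x y z : Ref ι α)
  | seq (p q : Prog ι α)
  | ite (b : Test ι α) (p q : Prog ι α)
  | while (b : Test ι α) (p : Prog ι α)

def IdxOp.eval : IdxOp → ℕ → ℕ → ℕ
  | .add, m, n => m + n
  | .sub, m, n => m - n
  | .mul, m, n => m * n

def RatOp.eval : RatOp → ℚ → ℚ → ℚ
  | .add, p, q => p + q
  | .sub, p, q => p - q
  | .mul, p, q => p * q
  | .div, p, q => p / q

variable {ι α : Type}

/-- The number of the cell, inside its array, that a reference denotes in the state `σ`. -/
def Ref.pos (σ : State ι α) : Ref ι α → ℕ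
  | .direct _ k => k
  | .indirect _ i => σ.idx i

/-- The array that a reference belongs to. -/
def Ref.name : Ref ι α → α
  | .direct a _ => a
  | .indirect a _ => a

/-- The content of a referenced cell. -/
def State.get (σ : State ι α) (x : Ref ι α) : ℚ := σ.arr x.name (x.pos σ)

/-- Write `v` to the index register `i`. -/
def State.setIdx [DecidableEq ι] (σ : State ι α) (i : ι) (v : ℕ) : State ι α :=
  { σ with idx := Function.update σ.idx i v }

/-- Write `v` to the referenced cell. -/
def State.set [DecidableEq α] (σ : State ι α) (x : Ref ι α) (v : ℚ) : State ι α :=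
  { σ with arr := Function.update σ.arr x.name (Function.update (σ.arr x.name) (x.pos σ) v) }

def Test.Holds (σ : State ι α) : Test ι α → Prop
  | .idxLt i j => σ.idx i < σ.idx j
  | .idxEq i j => σ.idx i = σ.idx j
  | .ratLt x y => σ.get x < σ.get y
  | .ratEq x y => σ.get x = σ.get y

/-- `Exec B p σ t τ`: started in the state `σ`, the program `p` halts in the state `τ` after exactly
`t` steps, never divides by zero, and every number that it produces on the way, be it a rational
or an index, has encoding length at most `B`. -/
inductive Exec [DecidableEq ι] [DecidableEq α] (B : ℕ) :
    Prog ι α → State ι α → ℕ → State ι α → Prop where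
  | skip (σ : State ι α) : Exec B .skip σ 1 σ
  | idxConst (σ : State ι α) (i : ι) (k : ℕ) (hB : Nat.size k ≤ B) :
      Exec B (.idxConst i k) σ 1 (σ.setIdx i k)
  | idxCopy (σ : State ι α) (i j : ι) (hB : Nat.size (σ.idx j) ≤ B) :
      Exec B (.idxCopy i j) σ 1 (σ.setIdx i (σ.idx j))
  | idxArith (σ : State ι α) (o : IdxOp) (i j k : ι)
      (hB : Nat.size (o.eval (σ.idx j) (σ.idx k)) ≤ B) :
      Exec B (.idxArith o i j k) σ 1 (σ.setIdx i (o.eval (σ.idx j) (σ.idx k)))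
  | ratConst (σ : State ι α) (x : Ref ι α) (q : ℚ) (hB : ratSize q ≤ B) :
      Exec B (.ratConst x q) σ 1 (σ.set x q)
  | ratCopy (σ : State ι α) (x y : Ref ι α) (hB : ratSize (σ.get y) ≤ B) :
      Exec B (.ratCopy x y) σ 1 (σ.set x (σ.get y))
  | ratArith (σ : State ι α) (o : RatOp) (x y z : Ref ι α)
      (hdiv : o = .div → σ.get z ≠ 0)
      (hB : ratSize (o.eval (σ.get y) (σ.get z)) ≤ B) :
      Exec B (.ratArith o x y z) σ 1 (σ.set x (o.eval (σ.get y) (σ.get z)))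
  | seq {σ ρ τ : State ι α} {p q : Prog ι α} {t u : ℕ}
      (hp : Exec B p σ t ρ) (hq : Exec B q ρ u τ) : Exec B (.seq p q) σ (t + u) τ
  | iteTrue {σ τ : State ι α} {b : Test ι α} {p : Prog ι α} (q : Prog ι α) {t : ℕ}
      (hb : b.Holds σ) (hp : Exec B p σ t τ) : Exec B (.ite b p q) σ (1 + t) τ
  | iteFalse {σ τ : State ι α} {b : Test ι α} (p : Prog ι α) {q : Prog ι α} {t : ℕ}
      (hb : ¬ b.Holds σ) (hq : Exec B q σ t τ) : Exec B (.ite b p q) σ (1 + t) τ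
  | whileTrue {σ ρ τ : State ι α} {b : Test ι α} {p : Prog ι α} {t u : ℕ}
      (hb : b.Holds σ) (hp : Exec B p σ t ρ) (hw : Exec B (.while b p) ρ u τ) :
      Exec B (.while b p) σ (1 + t + u) τ
  | whileFalse {σ : State ι α} {b : Test ι α} (p : Prog ι α) (hb : ¬ b.Holds σ) :
      Exec B (.while b p) σ 1 σ

end RatRAM

/-! ### Binary `s`-partite quadratic optimization -/

open scoped Matrix

/-- An instance with `s` blocks of variables: maximize
`∑_{i<j} (xⁱ)ᵀ Q^{i,j} xʲ + ∑_j (cʲ)ᵀ xʲ` over `xʲ ∈ {0,1}^{n j}`. -/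
structure QuadInstance (s : ℕ) where
  n : Fin s → ℕ
  n_pos : ∀ j, 0 < n j
  Q : ∀ i j : Fin s, i < j → Matrix (Fin (n i)) (Fin (n j)) ℚ
  c : ∀ j : Fin s, Fin (n j) → ℚ

namespace QuadInstance

open RatRAM

variable {s : ℕ}

/-- The objective function. -/
def obj (P : QuadInstance s) (x : ∀ j, Fin (P.n j) → ℚ) : ℚ :=
  (∑ i, ∑ j, if h : i < j then x i ⬝ᵥ (P.Q i j h *ᵥ x j) else 0) + ∑ j, P.c j ⬝ᵥ x j

/-- The feasible set: all entries are `0` or `1`. -/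
def feasible (P : QuadInstance s) : Set (∀ j, Fin (P.n j) → ℚ) :=
  {x | ∀ j k, x j k = 0 ∨ x j k = 1}

/-- `x` is an optimal solution. -/
def IsOptimal (P : QuadInstance s) (x : ∀ j, Fin (P.n j) → ℚ) : Prop :=
  x ∈ P.feasible ∧ ∀ y ∈ P.feasible, P.obj y ≤ P.obj x

/-- The number of rational numbers in the data of the instance. -/
def dim (P : QuadInstance s) : ℕ :=
  (∑ i, ∑ j, if i < j then P.n i * P.n j else 0) + ∑ j, P.n j

/-- The total encoding length of the data of the instance. -/
def bitSize (P : QuadInstance s) : ℕ :=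
  (∑ i, ∑ j, if h : i < j then ∑ k, ∑ l, ratSize (P.Q i j h k l) else 0) +
    ∑ j, ∑ k, ratSize (P.c j k)

/-- Names of index registers: one for each dimension, and an unlimited supply for the work. -/
inductive Reg (s : ℕ) where
  | n (j : Fin s)
  | work (k : ℕ)
  deriving DecidableEq

/-- Names of arrays: the input matrices and vectors, the output vectors, and an unlimited supply
for the work. -/
inductive Arr (s : ℕ) where
  | Q (i j : Fin s)
  | c (j : Fin s)
  | x (j : Fin s)
  | work (k : ℕ)
  deriving DecidableEq

/-- The initial memory: the dimensions in their index registers, each matrix row by row in its array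
(entry `(k, l)` of `Q^{i,j}` in cell `l + n j * k`), each vector in its array, and zero in all
other places. -/
def input (P : QuadInstance s) : State (Reg s) (Arr s) where
  idx
    | .n j => P.n j
    | .work _ => 0
  arr
    | .Q i j, p =>
        if h : i < j ∧ p < P.n i * P.n j then
          P.Q i j h.1 (finProdFinEquiv.symm ⟨p, h.2⟩).1 (finProdFinEquiv.symm ⟨p, h.2⟩).2
        else 0
    | .c j, p => if h : p < P.n j then P.c j ⟨p, h⟩ else 0
    | .x _, _ => 0
    | .work _, _ => 0

/-- The vectors found in the output arrays. -/
def output (P : QuadInstance s) (σ : State (Reg s) (Arr s)) : ∀ j, Fin (P.n j) → ℚ :=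
  fun j k => σ.arr (.x j) k

end QuadInstance

/-!
Write all variables as one vector `x`, so that twice the objective is `q(x) = xᵀ M x + 2 cᵀ x` with
a symmetric matrix `M = U + Uᵀ` whose diagonal vanishes; here `U` has at most `s * s` nonzero
blocks of rank at most `r`. Since `q` is linear in each single entry of `x`, an optimal solution
with as few ones as possible satisfies `x v = 1 ↔ 0 < f v` for the gradient `f = c + M x`
(`BinaryQuadratic.exists_optimal`). No further use is made of the blocks. The vector `f` lies in
the column space of `[M | c]`, which has dimension at most `D + 1` with `D = 2 * (s * s * r)`
(`finrank_colSpace_le`), and so it remains to list, in polynomial time, all sets of positive places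
of the vectors of a space of bounded dimension.

A vector in a space of dimension at most `D + 1` is a conformal sum (one without cancellation) of
at most `D + 1` elementary vectors, each of which spans the subspace of all vectors that vanish in
some `D` (or fewer) given rows. Its set of positive places is therefore the union of theirs.
Passing to the subspace of the vectors that vanish in a row `r` is a fraction-free elimination step
with any nonzero pivot in that row (`colSpace_step`), whence every elementary vector is, up to a
positive factor, plus or minus a column of `[M | c]` after `D` elimination steps, some of which may
be idle. Such a signed column is given by `2 * D + 2` numbers from `0, …, N`, where `N` is the
number of variables, so that `(D + 1) * (2 * D + 2)` nested loops run through all candidates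
(`exists_items`, `exists_optimal_pattern`). The other candidates that the loops meet are feasible
too, and do no harm.

The program evaluates the entries after elimination by the recursion that defines them: this takes
a number of operations that depends on `D` only, and multiplies bit lengths by at most `4 ^ D`. Bit
lengths are controlled through the height `|num| + den`, which is submultiplicative for sums as
well as for products, so that long sums are harmless. Programs are verified with the predicate
`Total` for total correctness with a time bound, with an invariant rule for loops and with a
syntactic frame rule.
-/

/-! ### Heights of rational numbers -/

namespace RatRAM

/-- `q` has height at most `2 ^ b`. The height `|num| + den` is submultiplicative under sums,
differences and products alike, so that the exponents just add up along a computation. -/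
def HeightLe (b : ℕ) (q : ℚ) : Prop := q.num.natAbs + q.den ≤ 2 ^ b

theorem HeightLe.mono {b b' : ℕ} {q : ℚ} (h : HeightLe b q) (hb : b ≤ b') : HeightLe b' q :=
  le_trans h (Nat.pow_le_pow_right (by norm_num) hb)

theorem HeightLe.ratSize_le {b : ℕ} {q : ℚ} (h : HeightLe b q) : ratSize q ≤ 2 * b + 3 := by
  have h1 : q.num.natAbs < 2 ^ (b + 1) := by
    have := Nat.pow_lt_pow_right (a := 2) (by norm_num) (Nat.lt_succ_self b)
    unfold HeightLe at h; omega
  have h2 : q.den < 2 ^ (b + 1) := by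
    have := Nat.pow_lt_pow_right (a := 2) (by norm_num) (Nat.lt_succ_self b)
    unfold HeightLe at h; omega
  have := Nat.size_le.2 h1
  have := Nat.size_le.2 h2
  unfold ratSize; omega

theorem heightLe_ratSize (q : ℚ) : HeightLe (ratSize q) q := by
  have h1 := Nat.lt_size_self q.num.natAbs
  have h2 := Nat.lt_size_self q.den
  have e1 : 2 ^ Nat.size q.num.natAbs ≤ 2 ^ (Nat.size q.num.natAbs + Nat.size q.den) :=
    Nat.pow_le_pow_right (by norm_num) (by omega)
  have e2 : 2 ^ Nat.size q.den ≤ 2 ^ (Nat.size q.num.natAbs + Nat.size q.den) :=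
    Nat.pow_le_pow_right (by norm_num) (by omega)
  unfold HeightLe ratSize
  rw [add_assoc, pow_add]
  omega

/-- A fraction in any form bounds the height of its value. -/
theorem height_le_of_eq_div {q : ℚ} {n d : ℤ} (hd : d ≠ 0) (h : q = n / d) :
    q.num.natAbs + q.den ≤ n.natAbs + d.natAbs := by
  have h' : q = Rat.divInt n d := by rw [h, Rat.divInt_eq_div]
  have hden : q.den ≤ d.natAbs := by
    have : (q.den : ℤ) ∣ d := by rw [h']; exact Rat.den_dvd n d
    exact Nat.le_of_dvd (Int.natAbs_pos.2 hd) (by simpa using Int.natAbs_dvd_natAbs.2 this)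
  have hnum : q.num.natAbs ≤ n.natAbs := by
    by_cases hn : n = 0
    · have : q = 0 := by rw [h, hn]; simp
      simp [this]
    · have : q.num ∣ n := by rw [h']; exact Rat.num_dvd n hd
      exact Nat.le_of_dvd (Int.natAbs_pos.2 hn) (Int.natAbs_dvd_natAbs.2 this)
  omega

theorem HeightLe.mul {a b : ℕ} {p q : ℚ} (hp : HeightLe a p) (hq : HeightLe b q) :
    HeightLe (a + b) (p * q) := by
  have hne : (p.den : ℤ) * q.den ≠ 0 := by simp
  have h := height_le_of_eq_div (q := p * q) (n := p.num * q.num) (d := p.den * q.den) hne (by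
    push_cast
    rw [mul_div_mul_comm, Rat.num_div_den, Rat.num_div_den])
  have h1 := Nat.mul_le_mul hp hq
  unfold HeightLe
  rw [pow_add]
  rw [Int.natAbs_mul, Int.natAbs_mul, Int.natAbs_natCast, Int.natAbs_natCast] at h
  nlinarith [Nat.zero_le (p.num.natAbs * q.den), Nat.zero_le (p.den * q.num.natAbs),
    Nat.zero_le (p.num.natAbs * q.num.natAbs)]

theorem HeightLe.add {a b : ℕ} {p q : ℚ} (hp : HeightLe a p) (hq : HeightLe b q) :
    HeightLe (a + b) (p + q) := by
  have hne : (p.den : ℤ) * q.den ≠ 0 := by simp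
  have h := height_le_of_eq_div (q := p + q) (n := p.num * q.den + p.den * q.num)
    (d := p.den * q.den) hne (by
    push_cast
    rw [← div_add_div _ _ (by simp) (by simp), Rat.num_div_den, Rat.num_div_den])
  have h1 := Nat.mul_le_mul hp hq
  have h2 := Int.natAbs_add_le (p.num * q.den) (p.den * q.num)
  unfold HeightLe
  rw [pow_add]
  simp only [Int.natAbs_mul, Int.natAbs_natCast] at h h2
  nlinarith [Nat.zero_le (p.num.natAbs * q.den), Nat.zero_le (p.den * q.num.natAbs),
    Nat.zero_le (p.num.natAbs * q.num.natAbs)]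

theorem HeightLe.neg {a : ℕ} {p : ℚ} (hp : HeightLe a p) : HeightLe a (-p) := by
  simpa [HeightLe] using hp

theorem HeightLe.sub {a b : ℕ} {p q : ℚ} (hp : HeightLe a p) (hq : HeightLe b q) :
    HeightLe (a + b) (p - q) := by
  rw [sub_eq_add_neg]; exact hp.add hq.neg

theorem heightLe_zero : HeightLe 0 0 := by simp [HeightLe]
theorem heightLe_one : HeightLe 1 1 := by simp [HeightLe]
theorem heightLe_two : HeightLe 2 2 := by simp [HeightLe]

theorem heightLe_of_zero_or_one {q : ℚ} (h : q = 0 ∨ q = 1) : HeightLe 1 q := by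
  rcases h with rfl | rfl
  · exact heightLe_zero.mono (by norm_num)
  · exact heightLe_one

theorem natSize_le (n : ℕ) : Nat.size n ≤ n := Nat.size_le.2 Nat.lt_two_pow_self

/-! ### Total correctness with a time bound -/

set_option linter.unusedSectionVars false

variable {ι α : Type} [DecidableEq ι] [DecidableEq α]

/-- Started in `σ`, the program `p` halts after at most `T` steps in a state with `Post`, never
divides by zero and produces only numbers of encoding length at most `B`. -/
def Total (B T : ℕ) (p : Prog ι α) (σ : State ι α) (Post : State ι α → Prop) : Prop :=
  ∃ t τ, Exec B p σ t τ ∧ t ≤ T ∧ Post τ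

namespace Total

variable {B T T' : ℕ} {p q : Prog ι α} {σ : State ι α} {Post Post' : State ι α → Prop}

theorem mono (h : Total B T p σ Post) (hT : T ≤ T') (hP : ∀ τ, Post τ → Post' τ) :
    Total B T' p σ Post' := by
  obtain ⟨t, τ, h1, h2, h3⟩ := h
  exact ⟨t, τ, h1, h2.trans hT, hP _ h3⟩

theorem imp (h : Total B T p σ Post) (hP : ∀ τ, Post τ → Post' τ) : Total B T p σ Post' :=
  h.mono le_rfl hP

theorem skip (h : Post σ) : Total B 1 .skip σ Post := ⟨_, _, .skip σ, le_rfl, h⟩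

theorem idxConst {i : ι} {k : ℕ} (hB : k ≤ B) (h : Post (σ.setIdx i k)) :
    Total B 1 (.idxConst i k) σ Post :=
  ⟨_, _, .idxConst σ i k ((natSize_le _).trans hB), le_rfl, h⟩

theorem idxCopy {i j : ι} (hB : σ.idx j ≤ B) (h : Post (σ.setIdx i (σ.idx j))) :
    Total B 1 (.idxCopy i j) σ Post :=
  ⟨_, _, .idxCopy σ i j ((natSize_le _).trans hB), le_rfl, h⟩

theorem idxArith {o : IdxOp} {i j k : ι} (hB : o.eval (σ.idx j) (σ.idx k) ≤ B)
    (h : Post (σ.setIdx i (o.eval (σ.idx j) (σ.idx k)))) :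
    Total B 1 (.idxArith o i j k) σ Post :=
  ⟨_, _, .idxArith σ o i j k ((natSize_le _).trans hB), le_rfl, h⟩

theorem ratConst {x : Ref ι α} {v : ℚ} (hB : ratSize v ≤ B) (h : Post (σ.set x v)) :
    Total B 1 (.ratConst x v) σ Post :=
  ⟨_, _, .ratConst σ x v hB, le_rfl, h⟩

theorem ratCopy {x y : Ref ι α} (hB : ratSize (σ.get y) ≤ B) (h : Post (σ.set x (σ.get y))) :
    Total B 1 (.ratCopy x y) σ Post :=
  ⟨_, _, .ratCopy σ x y hB, le_rfl, h⟩

theorem ratArith {o : RatOp} {x y z : Ref ι α} (ho : o ≠ .div)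
    (hB : ratSize (o.eval (σ.get y) (σ.get z)) ≤ B)
    (h : Post (σ.set x (o.eval (σ.get y) (σ.get z)))) :
    Total B 1 (.ratArith o x y z) σ Post :=
  ⟨_, _, .ratArith σ o x y z (fun h => absurd h ho) hB, le_rfl, h⟩

theorem seq (h : Total B T p σ fun ρ => Total B T' q ρ Post) :
    Total B (T + T') (.seq p q) σ Post := by
  obtain ⟨t, ρ, h1, h2, u, τ, h3, h4, h5⟩ := h
  exact ⟨_, τ, .seq h1 h3, by omega, h5⟩

theorem ite {b : Test ι α} (hp : b.Holds σ → Total B T p σ Post)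
    (hq : ¬ b.Holds σ → Total B T q σ Post) : Total B (1 + T) (.ite b p q) σ Post := by
  by_cases hb : b.Holds σ
  · obtain ⟨t, τ, h1, h2, h3⟩ := hp hb
    exact ⟨_, τ, .iteTrue q hb h1, by omega, h3⟩
  · obtain ⟨t, τ, h1, h2, h3⟩ := hq hb
    exact ⟨_, τ, .iteFalse p hb h1, by omega, h3⟩

end Total

/-! ### Frames -/

/-- The program may write to the index register `i`. -/
def Prog.WritesIdx : Prog ι α → ι → Prop
  | .skip, _ => False
  | .idxConst j _, i => i = j
  | .idxCopy j _, i => i = j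
  | .idxArith _ j _ _, i => i = j
  | .ratConst _ _, _ => False
  | .ratCopy _ _, _ => False
  | .ratArith _ _ _ _, _ => False
  | .seq p q, i => p.WritesIdx i ∨ q.WritesIdx i
  | .ite _ p q, i => p.WritesIdx i ∨ q.WritesIdx i
  | .while _ p, i => p.WritesIdx i

/-- The program may write to the array `a`. -/
def Prog.WritesArr : Prog ι α → α → Prop
  | .skip, _ => False
  | .idxConst _ _, _ => False
  | .idxCopy _ _, _ => False
  | .idxArith _ _ _ _, _ => False
  | .ratConst x _, a => a = x.name
  | .ratCopy x _, a => a = x.name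
  | .ratArith _ x _ _, a => a = x.name
  | .seq p q, a => p.WritesArr a ∨ q.WritesArr a
  | .ite _ p q, a => p.WritesArr a ∨ q.WritesArr a
  | .while _ p, a => p.WritesArr a

@[simp] theorem State.setIdx_idx (σ : State ι α) (i j : ι) (v : ℕ) :
    (σ.setIdx i v).idx j = if j = i then v else σ.idx j := by
  simp [State.setIdx, Function.update_apply]

@[simp] theorem State.setIdx_arr (σ : State ι α) (i : ι) (v : ℕ) :
    (σ.setIdx i v).arr = σ.arr := rfl

@[simp] theorem State.set_idx (σ : State ι α) (x : Ref ι α) (v : ℚ) :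
    (σ.set x v).idx = σ.idx := rfl

theorem State.set_arr (σ : State ι α) (x : Ref ι α) (v : ℚ) (a : α) (k : ℕ) :
    (σ.set x v).arr a k = if a = x.name ∧ k = x.pos σ then v else σ.arr a k := by
  by_cases h : a = x.name
  · subst h; simp [State.set, Function.update_apply]
  · simp [State.set, h]

theorem State.set_arr_of_ne (σ : State ι α) (x : Ref ι α) (v : ℚ) {a : α} (h : a ≠ x.name) :
    (σ.set x v).arr a = σ.arr a := by
  funext k; simp [State.set_arr, h]

theorem Exec.frame {B t : ℕ} {p : Prog ι α} {σ τ : State ι α} (h : Exec B p σ t τ) :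
    (∀ i, ¬ p.WritesIdx i → τ.idx i = σ.idx i) ∧ (∀ a, ¬ p.WritesArr a → τ.arr a = σ.arr a) := by
  induction h with
  | skip | idxConst | idxCopy | idxArith =>
    simp +contextual [Prog.WritesIdx, Prog.WritesArr]
  | ratConst | ratCopy | ratArith =>
    refine ⟨by simp, fun a ha => ?_⟩
    exact State.set_arr_of_ne _ _ _ ha
  | seq _ _ ih1 ih2 =>
    simp only [Prog.WritesIdx, Prog.WritesArr, not_or]
    exact ⟨fun i hi => (ih2.1 i hi.2).trans (ih1.1 i hi.1),
      fun a ha => (ih2.2 a ha.2).trans (ih1.2 a ha.1)⟩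
  | iteTrue _ _ _ ih | iteFalse _ _ _ ih =>
    simp only [Prog.WritesIdx, Prog.WritesArr, not_or]
    exact ⟨fun i hi => ih.1 i (by tauto), fun a ha => ih.2 a (by tauto)⟩
  | whileTrue _ _ _ ih1 ih2 =>
    exact ⟨fun i hi => (ih2.1 i hi).trans (ih1.1 i hi),
      fun a ha => (ih2.2 a ha).trans (ih1.2 a ha)⟩
  | whileFalse => simp

theorem Total.frame {B T : ℕ} {p : Prog ι α} {σ : State ι α} {Post : State ι α → Prop}
    (h : Total B T p σ Post) :
    Total B T p σ fun τ => Post τ ∧ (∀ i, ¬ p.WritesIdx i → τ.idx i = σ.idx i) ∧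
      (∀ a, ¬ p.WritesArr a → τ.arr a = σ.arr a) := by
  obtain ⟨t, τ, h1, h2, h3⟩ := h
  exact ⟨t, τ, h1, h2, h3, h1.frame⟩

/-! ### Loops -/

/-- `for i = 0, …, n - 1 do p`, where `n` is a register; `tmp` receives the constant `1`. -/
def forUp (tmp i n : ι) (p : Prog ι α) : Prog ι α :=
  .seq (.idxConst i 0) (.while (.idxLt i n)
    (.seq p (.seq (.idxConst tmp 1) (.idxArith .add i i tmp))))

@[simp] theorem writesIdx_forUp (tmp i n : ι) (p : Prog ι α) (j : ι) :
    (forUp tmp i n p).WritesIdx j ↔ j = i ∨ j = tmp ∨ p.WritesIdx j := by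
  simp only [forUp, Prog.WritesIdx]; tauto

@[simp] theorem writesArr_forUp (tmp i n : ι) (p : Prog ι α) (a : α) :
    (forUp tmp i n p).WritesArr a ↔ p.WritesArr a := by
  simp [forUp, Prog.WritesArr]

/-- The invariant rule for `forUp`. The invariant `I k` speaks about the state after `k` rounds; it
may depend neither on the counter nor on `tmp`. -/
theorem Total.forUp {B T N : ℕ} {tmp i n : ι} {p : Prog ι α} {σ : State ι α}
    (I : ℕ → State ι α → Prop) (hti : i ≠ tmp) (htn : n ≠ tmp) (hin : n ≠ i)
    (hpi : ¬ p.WritesIdx i) (hpn : ¬ p.WritesIdx n) (hN : σ.idx n = N) (hB : N < B)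
    (h0 : I 0 σ)
    (hinv : ∀ k τ v, I k τ → I k (τ.setIdx i v))
    (hinv' : ∀ k τ v, I k τ → I k (τ.setIdx tmp v))
    (hstep : ∀ k τ, k < N → τ.idx i = k → I k τ → Total B T p τ (I (k + 1))) :
    Total B (N * (T + 3) + 2) (RatRAM.forUp tmp i n p) σ (I N) := by
  have main : ∀ m k τ, k + m = N → τ.idx i = k → τ.idx n = N → I k τ →
      Total B (m * (T + 3) + 1) (.while (.idxLt i n)
        (.seq p (.seq (.idxConst tmp 1) (.idxArith .add i i tmp)))) τ (I N) := by
    intro m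
    induction m with
    | zero =>
      intro k τ hk hi hn hI
      refine ⟨1, τ, .whileFalse _ ?_, by omega, ?_⟩
      · simp only [Test.Holds]; omega
      · simpa [← hk] using hI
    | succ m ih =>
      intro k τ hk hi hn hI
      have hbody : Total B (T + (1 + 1)) (.seq p (.seq (.idxConst tmp 1) (.idxArith .add i i tmp)))
          τ fun ρ => I (k + 1) ρ ∧ ρ.idx i = k + 1 ∧ ρ.idx n = N := by
        refine Total.seq ((hstep k τ (by omega) hi hI).frame.imp ?_)
        rintro ρ ⟨hρ, hf, -⟩
        have e1 : ρ.idx i = k := (hf i hpi).trans hi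
        have e2 : ρ.idx n = N := (hf n hpn).trans hn
        refine Total.seq (Total.idxConst (by omega) (Total.idxArith ?_ ⟨?_, ?_, ?_⟩))
        · simp [IdxOp.eval, hti, e1]; omega
        · exact hinv _ _ _ (hinv' _ _ _ hρ)
        · simp [IdxOp.eval, hti, e1]
        · simp [hin, htn, e2]
      obtain ⟨t, ρ, h1, h2, h3, h4, h5⟩ := hbody
      obtain ⟨u, θ, h6, h7, h8⟩ := ih (k + 1) ρ (by omega) h4 h5 h3
      refine ⟨_, θ, .whileTrue ?_ h1 h6, ?_, h8⟩
      · simp only [Test.Holds]; omega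
      · rw [Nat.succ_mul]; omega
  have : Total B (1 + (N * (T + 3) + 1)) (RatRAM.forUp tmp i n p) σ (I N) :=
    Total.seq (Total.idxConst (by omega)
      (main N 0 _ (by omega) (by simp) (by simp [hin, hN]) (hinv _ _ _ h0)))
  exact this.mono (by omega) fun _ h => h

/-- Run the programs of a list one after the other. -/
def seqList : List (Prog ι α) → Prog ι α
  | [] => .skip
  | p :: l => .seq p (seqList l)

theorem writesIdx_seqList (l : List (Prog ι α)) (i : ι) :
    (seqList l).WritesIdx i ↔ ∃ p ∈ l, p.WritesIdx i := by
  induction l <;> simp_all [seqList, Prog.WritesIdx]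

theorem writesArr_seqList (l : List (Prog ι α)) (a : α) :
    (seqList l).WritesArr a ↔ ∃ p ∈ l, p.WritesArr a := by
  induction l <;> simp_all [seqList, Prog.WritesArr]

/-- If every program of a family preserves `I` and all the properties `F x`, and establishes its own
`F x`, then running them one after the other establishes all of them. -/
theorem Total.seqList_map {β : Type*} {B T : ℕ} (f : β → Prog ι α) (I : State ι α → Prop)
    (F : β → State ι α → Prop) (l : List β) {σ : State ι α} (h0 : I σ)
    (hstep : ∀ x τ, x ∈ l → I τ →
      Total B T (f x) τ fun ρ => I ρ ∧ F x ρ ∧ ∀ y, F y τ → F y ρ) :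
    Total B (l.length * T + 1) (seqList (l.map f)) σ
      fun ρ => I ρ ∧ (∀ x ∈ l, F x ρ) ∧ ∀ y, F y σ → F y ρ := by
  induction l generalizing σ with
  | nil => exact (Total.skip ⟨h0, by simp, fun _ h => h⟩).mono (by simp) fun _ h => h
  | cons x l ih =>
    have : Total B (T + (l.length * T + 1)) (seqList ((x :: l).map f)) σ
      fun ρ => I ρ ∧ (∀ y ∈ x :: l, F y ρ) ∧ ∀ y, F y σ → F y ρ := by
      refine Total.seq ((hstep x σ (by simp) h0).imp ?_)
      rintro ρ ⟨h1, h2, h3⟩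
      refine (ih h1 fun y τ hy => hstep y τ (by simp [hy])).imp ?_
      rintro θ ⟨h4, h5, h6⟩
      refine ⟨h4, ?_, fun y hy => h6 y (h3 y hy)⟩
      intro z hz
      rcases List.mem_cons.1 hz with h | h
      · exact h ▸ h6 _ h2
      · exact h5 z h
    exact this.mono (by simp [Nat.succ_mul]; omega) fun _ h => h

/-- Nested loops: `p` is run for all values of the registers of the list that are smaller than the
value of the register `n`. -/
def enum (tmp n : ι) (p : Prog ι α) : List ι → Prog ι α
  | [] => p
  | x :: l => forUp tmp x n (enum tmp n p l)

theorem writesIdx_enum (tmp n : ι) (p : Prog ι α) (l : List ι) {j : ι}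
    (h : (enum tmp n p l).WritesIdx j) : j ∈ l ∨ j = tmp ∨ p.WritesIdx j := by
  induction l with
  | nil => exact .inr (.inr h)
  | cons x l ih =>
    rcases (writesIdx_forUp ..).1 h with h | h | h
    · exact .inl (by simp [h])
    · exact .inr (.inl h)
    · exact (ih h).imp_left fun h => by simp [h]

/-- The running time of nested loops whose body takes time `T`. -/
def enumTime (N T : ℕ) : ℕ → ℕ
  | 0 => T
  | k + 1 => N * (enumTime N T k + 3) + 2

/-- If the body raises the value `best` to at least the score of the present values of the loop
registers, then the nested loops raise it to at least the score of all admissible values. -/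
theorem Total.enum {B T N : ℕ} {tmp n : ι} {p : Prog ι α} (V : Set ι) (score : (ι → ℕ) → ℚ)
    (best : State ι α → ℚ) (Inv : State ι α → Prop) (hVtmp : tmp ∉ V) (hVn : n ∉ V) (hnt : n ≠ tmp)
    (hpV : ∀ x ∈ V, ¬ p.WritesIdx x) (hpn : ¬ p.WritesIdx n) (hB : N < B)
    (hn : ∀ τ, Inv τ → τ.idx n = N)
    (hscore : ∀ a b, (∀ x ∈ V, a x = b x) → score a = score b)
    (hInv : ∀ τ x v, x ∈ V ∨ x = tmp → Inv τ → Inv (τ.setIdx x v))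
    (hbest : ∀ τ x v, best (τ.setIdx x v) = best τ)
    (hbody : ∀ τ, Inv τ → (∀ x ∈ V, τ.idx x < N) →
      Total B T p τ fun ρ => Inv ρ ∧ best τ ≤ best ρ ∧ score τ.idx ≤ best ρ)
    (l : List ι) (hl : l.Nodup) (hlV : ∀ x ∈ l, x ∈ V) {σ : State ι α} (hσ : Inv σ)
    (hσN : ∀ x ∈ V, x ∉ l → σ.idx x < N) :
    Total B (enumTime N T l.length) (RatRAM.enum tmp n p l) σ fun τ => Inv τ ∧ best σ ≤ best τ ∧
      ∀ a : ι → ℕ, (∀ x ∈ V, a x < N) → (∀ x ∈ V, x ∉ l → a x = σ.idx x) → score a ≤ best τ := by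
  induction l generalizing σ with
  | nil =>
    refine (hbody σ hσ fun x hx => hσN x hx (by simp)).imp fun τ h => ⟨h.1, h.2.1, fun a _ ha => ?_⟩
    rw [hscore a σ.idx fun x hx => ha x hx (by simp)]
    exact h.2.2
  | cons x l ih =>
    obtain ⟨hxl, hl⟩ := List.nodup_cons.1 hl
    have hxV : x ∈ V := hlV x (by simp)
    have hlV' : ∀ y ∈ l, y ∈ V := fun y hy => hlV y (by simp [hy])
    have hxt : x ≠ tmp := fun h => hVtmp (h ▸ hxV)
    have hnx : n ≠ x := fun h => hVn (h ▸ hxV)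
    have hw : ∀ y, y ∉ l → y ≠ tmp → ¬ p.WritesIdx y → ¬ (RatRAM.enum tmp n p l).WritesIdx y := by
      intro y h1 h2 h3 h
      rcases writesIdx_enum _ _ _ _ h with h | h | h <;> contradiction
    let I : ℕ → State ι α → Prop := fun k τ => Inv τ ∧ best σ ≤ best τ ∧
      (∀ y ∈ V, y ∉ x :: l → τ.idx y = σ.idx y) ∧
      ∀ a : ι → ℕ, (∀ y ∈ V, a y < N) → (∀ y ∈ V, y ∉ x :: l → a y = σ.idx y) → a x < k →
        score a ≤ best τ
    refine (Total.forUp (T := enumTime N T l.length) (N := N) I hxt hnt hnx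
      (hw x hxl hxt (hpV x hxV))
      (hw n (fun h => hVn (hlV' n h)) hnt hpn) (hn σ hσ) hB ⟨hσ, le_rfl, fun _ _ _ => rfl, ?_⟩ ?_ ?_
      ?_).imp ?_
    · intro a _ _ h; omega
    · rintro k τ v ⟨h1, h2, h3, h4⟩
      refine ⟨hInv τ x v (.inl hxV) h1, by rwa [hbest], fun y hy hyl => ?_,
        by simpa [hbest] using h4⟩
      rw [State.setIdx_idx, if_neg (fun h => hyl (by simp [h])), h3 y hy hyl]
    · rintro k τ v ⟨h1, h2, h3, h4⟩
      refine ⟨hInv τ tmp v (.inr rfl) h1, by rwa [hbest], fun y hy hyl => ?_,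
        by simpa [hbest] using h4⟩
      rw [State.setIdx_idx, if_neg (fun h : y = tmp => hVtmp (h ▸ hy)), h3 y hy hyl]
    · rintro k τ hk hτ ⟨h1, h2, h3, h4⟩
      refine (ih hl hlV' h1 ?_).frame.imp ?_
      · intro y hy hyl
        by_cases hyx : y = x
        · rw [hyx, hτ]; exact hk
        · have hyl' : y ∉ x :: l := by simp [hyx, hyl]
          rw [h3 y hy hyl']; exact hσN y hy hyl'
      · rintro ρ ⟨⟨h5, h6, h7⟩, hf, -⟩
        refine ⟨h5, h2.trans h6, fun y hy hyl => ?_, fun a ha hal hax => ?_⟩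
        · rw [hf y (hw y (fun h => hyl (by simp [h])) (fun h => hVtmp (h ▸ hy)) (hpV y hy)),
            h3 y hy hyl]
        · rcases Nat.lt_succ_iff_lt_or_eq.1 hax with h | h
          · exact (h4 a ha hal h).trans h6
          · refine h7 a ha fun y hy hyl => ?_
            by_cases hyx : y = x
            · rw [hyx, hτ, h]
            · have hyl' : y ∉ x :: l := by simp [hyx, hyl]
              rw [hal y hy hyl', h3 y hy hyl']
    · rintro τ ⟨h1, h2, -, h4⟩
      exact ⟨h1, h2, fun a ha hal => h4 a ha hal (ha x hxV)⟩

end RatRAM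

/-! ### Sign patterns of the vectors of a column space -/

namespace PivotElim

/-- One fraction-free elimination step on the columns of `g`, with pivot row `p.1` and pivot column
`p.2`. A row index of at least `N` stands for "no elimination". -/
def step (N : ℕ) (p : ℕ × ℕ) (g : ℕ → ℕ → ℚ) (k c : ℕ) : ℚ :=
  if p.1 < N then g k c * g p.1 p.2 - g k p.2 * g p.1 c else g k c

/-- The matrix after elimination with the pivots `piv 0, …, piv (m - 1)`. -/
def elim (N : ℕ) (g : ℕ → ℕ → ℚ) (piv : ℕ → ℕ × ℕ) : ℕ → ℕ → ℕ → ℚ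
  | 0 => g
  | m + 1 => step N (piv m) (elim N g piv m)

/-- Put `a` in front of a sequence. -/
def cons {β : Type*} (a : β) (u : ℕ → β) : ℕ → β
  | 0 => a
  | k + 1 => u k

theorem elim_cons (N : ℕ) (g : ℕ → ℕ → ℚ) (p : ℕ × ℕ) (piv : ℕ → ℕ × ℕ) (m : ℕ) :
    elim N g (cons p piv) (m + 1) = elim N (step N p g) piv m := by
  induction m with
  | zero => rfl
  | succ m ih => rw [elim, ih]; rfl

/-- The column `c` of the `N`-rowed matrix `g`. -/
def col (N : ℕ) (g : ℕ → ℕ → ℚ) (c : ℕ) : Fin N → ℚ := fun k => g k c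

/-- The space spanned by the columns `0, …, N` of the `N`-rowed matrix `g`. -/
def colSpace (N : ℕ) (g : ℕ → ℕ → ℚ) : Submodule ℚ (Fin N → ℚ) :=
  Submodule.span ℚ (col N g '' Set.Iic N)

theorem exists_col_ne_zero {N : ℕ} {g : ℕ → ℕ → ℚ} {f : Fin N → ℚ} (hf : f ∈ colSpace N g)
    {r : Fin N} (hr : f r ≠ 0) : ∃ c ≤ N, g r c ≠ 0 := by
  by_contra! h
  have : colSpace N g ≤ LinearMap.ker (LinearMap.proj r : (Fin N → ℚ) →ₗ[ℚ] ℚ) := by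
    rw [colSpace, Submodule.span_le]
    rintro _ ⟨c, hc, rfl⟩
    simpa [col] using h c hc
  exact hr (by simpa using this hf)

/-- Eliminating with a nonzero pivot in the row `r` restricts the column space to the vectors that
vanish at `r`. -/
theorem colSpace_step {N : ℕ} {g : ℕ → ℕ → ℚ} {r : Fin N} {c₀ : ℕ} (hc₀ : c₀ ≤ N)
    (hp : g r c₀ ≠ 0) (f : Fin N → ℚ) :
    f ∈ colSpace N (step N (r, c₀) g) ↔ f ∈ colSpace N g ∧ f r = 0 := by
  have hcol : ∀ c, col N (step N (r, c₀) g) c = g r c₀ • col N g c - g r c • col N g c₀ := by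
    intro c; funext k; simp [col, step]; ring
  have hmem : ∀ c ≤ N, col N g c ∈ colSpace N g := fun c hc =>
    Submodule.subset_span ⟨c, hc, rfl⟩
  constructor
  · intro hf
    have h1 : colSpace N (step N (r, c₀) g) ≤
        colSpace N g ⊓ LinearMap.ker (LinearMap.proj r : (Fin N → ℚ) →ₗ[ℚ] ℚ) := by
      rw [colSpace, Submodule.span_le]
      rintro _ ⟨c, hc, rfl⟩
      refine ⟨?_, ?_⟩
      · rw [hcol]
        exact Submodule.sub_mem _ (Submodule.smul_mem _ _ (hmem c hc))
          (Submodule.smul_mem _ _ (hmem c₀ hc₀))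
      · simp [hcol, col]; ring
    simpa using h1 hf
  · rintro ⟨hf, hr⟩
    have h2 : ∀ h ∈ colSpace N g,
        g r c₀ • h - h r • col N g c₀ ∈ colSpace N (step N (r, c₀) g) := by
      intro h hh
      induction hh using Submodule.span_induction with
      | mem x hx =>
        obtain ⟨c, hc, rfl⟩ := hx
        have := hcol c
        exact Submodule.subset_span ⟨c, hc, this⟩
      | zero => simp
      | add x y _ _ hx hy =>
        convert Submodule.add_mem _ hx hy using 1
        simp only [Pi.add_apply, add_smul, smul_add]; abel
      | smul a x _ hx =>
        convert Submodule.smul_mem _ a hx using 1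
        simp only [Pi.smul_apply, smul_sub, smul_smul, smul_eq_mul, mul_comm]
    have h3 := h2 f hf
    rw [hr, zero_smul, sub_zero] at h3
    have := Submodule.smul_mem _ (g r c₀)⁻¹ h3
    rwa [smul_smul, inv_mul_cancel₀ hp, one_smul] at this

theorem finrank_colSpace_step {N m : ℕ} {g : ℕ → ℕ → ℚ} {r : Fin N} {c₀ : ℕ} (hc₀ : c₀ ≤ N)
    (hp : g r c₀ ≠ 0) (hm : Module.finrank ℚ (colSpace N g) ≤ m + 1) :
    Module.finrank ℚ (colSpace N (step N (r, c₀) g)) ≤ m := by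
  have hlt : colSpace N (step N (r, c₀) g) < colSpace N g := by
    refine lt_of_le_of_ne (fun f hf => ((colSpace_step hc₀ hp f).1 hf).1) fun h => ?_
    have h1 : col N g c₀ ∈ colSpace N g := Submodule.subset_span ⟨c₀, hc₀, rfl⟩
    rw [← h] at h1
    exact hp ((colSpace_step hc₀ hp _).1 h1).2
  have := Submodule.finrank_lt_finrank_of_lt hlt
  omega

/-- `e` is conformal to `f`: where `f` is positive, negative or zero, `e` is nonnegative,
nonpositive or zero. -/
def Conformal {N : ℕ} (e f : Fin N → ℚ) : Prop := ∀ k, ∃ t : ℚ, 0 ≤ t ∧ e k = t * f k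

theorem Conformal.trans {N : ℕ} {e f h : Fin N → ℚ} (h1 : Conformal e f) (h2 : Conformal f h) :
    Conformal e h := by
  intro k
  obtain ⟨t, ht, e1⟩ := h1 k
  obtain ⟨u, hu, e2⟩ := h2 k
  exact ⟨t * u, mul_nonneg ht hu, by rw [e1, e2, mul_assoc]⟩

/-- Moving from `f` in the direction `-g`, where `g` vanishes wherever `f` does and agrees in sign
with `f` at some place, a coordinate of `f` is the first one to become zero. -/
theorem exists_conformal_sub {N : ℕ} {f g : Fin N → ℚ} (hsupp : ∀ k, f k = 0 → g k = 0)
    (hpos : ∃ k, 0 < g k / f k) :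
    ∃ t : ℚ, 0 < t ∧ Conformal (f - t • g) f ∧ ∃ r, (f - t • g) r = 0 ∧ f r ≠ 0 := by
  obtain ⟨k₀, hk₀⟩ := hpos
  obtain ⟨r, -, hr⟩ := Finset.exists_max_image Finset.univ (fun k => g k / f k) ⟨k₀, by simp⟩
  have hρ : 0 < g r / f r := hk₀.trans_le (hr k₀ (by simp))
  have hfr : f r ≠ 0 := fun h => by simp [h] at hρ
  have hgr : g r ≠ 0 := fun h => by simp [h] at hρ
  refine ⟨(g r / f r)⁻¹, inv_pos.2 hρ, fun k => ?_, r, ?_, hfr⟩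
  · refine ⟨1 - (g r / f r)⁻¹ * (g k / f k), ?_, ?_⟩
    · have := mul_le_mul_of_nonneg_left (hr k (by simp)) (inv_pos.2 hρ).le
      rw [inv_mul_cancel₀ hρ.ne'] at this
      simpa using this
    · by_cases hfk : f k = 0
      · simp [hfk, hsupp k hfk]
      · simp only [Pi.sub_apply, Pi.smul_apply, smul_eq_mul]; field_simp
  · simp only [Pi.sub_apply, Pi.smul_apply, smul_eq_mul]; field_simp; ring

/-- Every nonzero vector `f` of a column space of dimension at most `m + 1` has a conformal nonzero
vector that is a multiple of a column after `m` elimination steps. -/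
theorem exists_elementary {N : ℕ} (m : ℕ) (g : ℕ → ℕ → ℚ) (f : Fin N → ℚ)
    (hm : Module.finrank ℚ (colSpace N g) ≤ m + 1) (hf : f ∈ colSpace N g) (hf0 : f ≠ 0) :
    ∃ (piv : ℕ → ℕ × ℕ) (c : ℕ) (a : ℚ), (∀ k, (piv k).1 ≤ N ∧ (piv k).2 ≤ N) ∧ c ≤ N ∧
      a • col N (elim N g piv m) c ≠ 0 ∧ a • col N (elim N g piv m) c ∈ colSpace N g ∧
      Conformal (a • col N (elim N g piv m) c) f := by
  induction m generalizing g f with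
  | zero =>
    obtain ⟨r, hr⟩ := Function.ne_iff.1 hf0
    obtain ⟨c, hc, hgc⟩ := exists_col_ne_zero hf hr
    have hcol : col N g c ∈ colSpace N g := Submodule.subset_span ⟨c, hc, rfl⟩
    obtain ⟨a, ha⟩ : ∃ a : ℚ, a • col N g c = f := by
      have := finrank_le_one_iff.1 (show Module.finrank ℚ (colSpace N g) ≤ 1 from hm)
      obtain ⟨v, hv⟩ := this
      obtain ⟨b, hb⟩ := hv ⟨_, hcol⟩
      obtain ⟨d, hd⟩ := hv ⟨_, hf⟩
      have hb' : b • (v : Fin N → ℚ) = col N g c := congrArg Subtype.val hb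
      have hd' : d • (v : Fin N → ℚ) = f := congrArg Subtype.val hd
      have hb0 : b ≠ 0 := by
        rintro rfl
        exact hgc (by simpa [col] using (congrFun hb' r).symm)
      exact ⟨d / b, by rw [← hb', ← hd', smul_smul, div_mul_cancel₀ _ hb0]⟩
    refine ⟨fun _ => (0, 0), c, a, by simp, hc, ?_⟩
    have he : col N (elim N g (fun _ => (0, 0)) 0) c = col N g c := rfl
    rw [he, ha]
    exact ⟨hf0, hf, fun k => ⟨1, zero_le_one, by simp⟩⟩
  | succ m ih =>
    -- It suffices to find a nonzero conformal vector with a further zero.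
    have key : ∀ (h : Fin N → ℚ) (r : Fin N) (u : Fin N → ℚ), h ∈ colSpace N g → h ≠ 0 →
        Conformal h f → h r = 0 → u ∈ colSpace N g → u r ≠ 0 →
        ∃ (piv : ℕ → ℕ × ℕ) (c : ℕ) (a : ℚ), (∀ k, (piv k).1 ≤ N ∧ (piv k).2 ≤ N) ∧ c ≤ N ∧
          a • col N (elim N g piv (m + 1)) c ≠ 0 ∧
          a • col N (elim N g piv (m + 1)) c ∈ colSpace N g ∧
          Conformal (a • col N (elim N g piv (m + 1)) c) f := by
      intro h r u hh hh0 hconf hr hu hur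
      obtain ⟨c₀, hc₀, hp⟩ := exists_col_ne_zero hu hur
      obtain ⟨piv, c, a, h1, h2, h3, h4, h5⟩ := ih (step N (r, c₀) g) h
        (finrank_colSpace_step hc₀ hp hm) ((colSpace_step hc₀ hp h).2 ⟨hh, hr⟩) hh0
      refine ⟨cons ((r : ℕ), c₀) piv, c, a, ?_, h2, ?_⟩
      · rintro (_ | k)
        · exact ⟨r.2.le, hc₀⟩
        · exact h1 k
      · rw [elim_cons]
        exact ⟨h3, ((colSpace_step hc₀ hp _).1 h4).1, h5.trans hconf⟩
    by_cases hm' : Module.finrank ℚ (colSpace N g) ≤ m + 1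
    · obtain ⟨piv, c, a, h1, h2, h3⟩ := ih g f hm' hf hf0
      have hskip : step N (N, 0) g = g := by funext k c; simp [step]
      refine ⟨cons (N, 0) piv, c, a, ?_, h2, ?_⟩
      · rintro (_ | k)
        · exact ⟨le_rfl, Nat.zero_le _⟩
        · exact h1 k
      · rwa [elim_cons, hskip]
    · by_cases hA : ∃ (r : Fin N) (u : Fin N → ℚ), f r = 0 ∧ u ∈ colSpace N g ∧ u r ≠ 0
      · obtain ⟨r, u, hr, hu, hur⟩ := hA
        exact key f r u hf hf0 (fun k => ⟨1, zero_le_one, by simp⟩) hr hu hur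
      · push Not at hA
        obtain ⟨u, hu, hus⟩ : ∃ u ∈ colSpace N g, u ∉ Submodule.span ℚ {f} := by
          by_contra! hle
          have h1 := Submodule.finrank_mono (show colSpace N g ≤ Submodule.span ℚ {f} from hle)
          have h2 := finrank_span_le_card (R := ℚ) ({f} : Set (Fin N → ℚ))
          simp at h2
          omega
        -- One of the two directions `u` and `-u` agrees in sign with `f` at some place.
        have hdir : ∃ u ∈ colSpace N g, u ∉ Submodule.span ℚ {f} ∧ ∃ k, 0 < u k / f k := by
          obtain ⟨k, hk⟩ := Function.ne_iff.1
            (show u ≠ 0 from fun h => hus (h ▸ Submodule.zero_mem _))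
          have hfk : f k ≠ 0 := fun h => hk (hA k u h hu)
          rcases lt_or_gt_of_ne (div_ne_zero hk hfk) with h | h
          · exact ⟨-u, Submodule.neg_mem _ hu, by simpa using hus, k, by
              simpa [neg_div] using h⟩
          · exact ⟨u, hu, hus, k, h⟩
        obtain ⟨u, hu, hus, hpos⟩ := hdir
        obtain ⟨t, ht, hconf, r, hr, hfr⟩ :=
          exists_conformal_sub (fun k hk => hA k u hk hu) hpos
        refine key (f - t • u) r f (Submodule.sub_mem _ hf (Submodule.smul_mem _ _ hu)) ?_ hconf
          hr hf hfr
        intro h0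
        have : u = t⁻¹ • f := by
          rw [sub_eq_zero.1 h0, smul_smul, inv_mul_cancel₀ ht.ne', one_smul]
        exact hus (this ▸ Submodule.smul_mem _ _ (Submodule.mem_span_singleton_self f))

/-- A signed column after elimination is coded by a sequence `it`: the sign (`0` for plus), the
column, and then alternately the rows and the columns of the pivots. This is the `m`-th pivot. -/
def pivots (it : ℕ → ℕ) (m : ℕ) : ℕ × ℕ := (it (2 * m + 2), it (2 * m + 3))

/-- The signed column given by `it`, after `D` elimination steps, is positive in the row `k`. -/
def ItemPos (N : ℕ) (g : ℕ → ℕ → ℚ) (D : ℕ) (it : ℕ → ℕ) (k : ℕ) : Prop :=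
  if it 0 = 0 then 0 < elim N g (pivots it) D k (it 1) else elim N g (pivots it) D k (it 1) < 0

theorem exists_item {N D : ℕ} (hN : 0 < N) (g : ℕ → ℕ → ℚ) (piv : ℕ → ℕ × ℕ) {c : ℕ} {a : ℚ}
    (hpiv : ∀ k, (piv k).1 ≤ N ∧ (piv k).2 ≤ N) (hc : c ≤ N) (ha : a ≠ 0) :
    ∃ it : ℕ → ℕ, (∀ q, it q ≤ N) ∧
      ∀ k : Fin N, ItemPos N g D it k ↔ 0 < (a • col N (elim N g piv D) c) k := by
  let rest : ℕ → ℕ := fun q => if q % 2 = 0 then (piv (q / 2)).1 else (piv (q / 2)).2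
  let it : ℕ → ℕ := cons (if 0 < a then 0 else 1) (cons c rest)
  have hp : pivots it = piv := by
    funext m
    refine Prod.ext ?_ ?_
    · simp [pivots, it, cons, rest]
    · change rest (2 * m + 1) = _
      have h1 : (2 * m + 1) % 2 = 1 := by omega
      have h2 : (2 * m + 1) / 2 = m := by omega
      simp [rest, h1, h2]
  refine ⟨it, ?_, ?_⟩
  · rintro (_ | _ | q)
    · simp only [it, cons]; split_ifs <;> omega
    · exact hc
    · simp only [it, cons, rest]; split_ifs
      · exact (hpiv _).1
      · exact (hpiv _).2
  · intro k
    simp only [ItemPos, hp, Pi.smul_apply, smul_eq_mul, col]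
    simp only [it, cons]
    rcases lt_or_gt_of_ne ha with h | h
    · simp [h.not_gt, mul_pos_iff, h]
    · simp [h]

/-- The positive places of a nonzero vector in a column space of dimension at most `D + 1` are the
union of those of `D + 1` signed columns after `D` elimination steps: the vector is a conformal sum
of elementary ones. -/
theorem exists_items {N : ℕ} (hN : 0 < N) (D : ℕ) (g : ℕ → ℕ → ℚ) (f : Fin N → ℚ)
    (hD : Module.finrank ℚ (colSpace N g) ≤ D + 1) (hf : f ∈ colSpace N g) (hf0 : f ≠ 0) :
    ∃ its : ℕ → ℕ → ℕ, (∀ i q, its i q ≤ N) ∧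
      ∀ k : Fin N, 0 < f k ↔ ∃ i ≤ D, ItemPos N g D (its i) k := by
  induction D using Nat.strong_induction_on generalizing g f with | _ D ih =>
  obtain ⟨piv, c, a, hpiv, hc, he0, he, hconf⟩ := exists_elementary D g f hD hf hf0
  have ha : a ≠ 0 := by rintro rfl; simp at he0
  obtain ⟨it, hit, hpos⟩ := exists_item (D := D) hN g piv hpiv hc ha
  generalize a • col N (elim N g piv D) c = e at *
  obtain ⟨k, hk⟩ := Function.ne_iff.1 he0
  obtain ⟨t, ht, hconf', r, hr, hfr⟩ := exists_conformal_sub (f := f) (g := e)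
    (fun k hk => by obtain ⟨u, -, hu⟩ := hconf k; simp [hu, hk])
    ⟨k, by
      obtain ⟨u, hu0, hu⟩ := hconf k
      have hfk : f k ≠ 0 := fun h => hk (by simp [hu, h])
      have : u ≠ 0 := fun h => hk (by simp [hu, h])
      rw [hu, mul_div_cancel_right₀ _ hfk]
      exact lt_of_le_of_ne hu0 this.symm⟩
  have hsum : ∀ k, 0 < f k ↔ 0 < e k ∨ 0 < (f - t • e) k := by
    intro k
    constructor
    · intro h
      by_contra! hn
      have h1 := hn.2
      simp only [Pi.sub_apply, Pi.smul_apply, smul_eq_mul] at h1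
      have := mul_nonpos_of_nonneg_of_nonpos ht.le hn.1
      linarith
    · rintro (h | h)
      · obtain ⟨u, hu0, hu⟩ := hconf k
        by_contra hn
        have := mul_nonpos_of_nonneg_of_nonpos hu0 (not_lt.1 hn)
        linarith
      · obtain ⟨u, hu0, hu⟩ := hconf' k
        by_contra hn
        have := mul_nonpos_of_nonneg_of_nonpos hu0 (not_lt.1 hn)
        linarith
  by_cases hf' : f - t • e = 0
  · refine ⟨fun _ => it, fun _ => hit, fun k => ?_⟩
    rw [hsum, hf', ← hpos]
    simp only [Pi.zero_apply, lt_irrefl, or_false]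
    exact ⟨fun h => ⟨0, Nat.zero_le _, h⟩, fun ⟨_, _, h⟩ => h⟩
  · obtain ⟨c₀, hc₀, hp⟩ := exists_col_ne_zero hf hfr
    have hmem := (colSpace_step hc₀ hp (f - t • e)).2
      ⟨Submodule.sub_mem _ hf (Submodule.smul_mem _ _ he), hr⟩
    have hrank := finrank_colSpace_step hc₀ hp hD
    cases D with
    | zero =>
      have h0 : colSpace N (step N (r, c₀) g) = ⊥ := Submodule.finrank_eq_zero.1 (by omega)
      rw [h0] at hmem
      exact absurd (by simpa using hmem) hf'
    | succ D =>
      obtain ⟨its, hits, hposs⟩ := ih D (by omega) (step N (r, c₀) g) (f - t • e) hrank hmem hf'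
      -- The pivot `(r, c₀)` goes in front of the pivots of the remaining items.
      let ext : (ℕ → ℕ) → ℕ → ℕ := fun it => cons (it 0) (cons (it 1) (cons (r : ℕ) (cons c₀
        fun q => it (q + 2))))
      have hext : ∀ it, pivots (ext it) = cons ((r : ℕ), c₀) (pivots it) := by
        intro it; funext m; cases m <;> rfl
      refine ⟨cons it fun i => ext (its i), ?_, fun k => ?_⟩
      · rintro (_ | i) q
        · exact hit q
        · rcases q with _ | _ | _ | _ | q
          · exact hits _ _
          · exact hits _ _
          · exact r.2.le
          · exact hc₀
          · exact hits _ _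
      · have hrec : ∀ i, ItemPos N g (D + 1) (ext (its i)) k ↔
            ItemPos N (step N (r, c₀) g) D (its i) k := by
          intro i
          simp only [ItemPos, hext, elim_cons]
          exact Iff.rfl
        rw [hsum, ← hpos, hposs]
        constructor
        · rintro (h | ⟨i, hi, h⟩)
          · exact ⟨0, Nat.zero_le _, h⟩
          · exact ⟨i + 1, by omega, (hrec i).2 h⟩
        · rintro ⟨_ | i, hi, h⟩
          · exact Or.inl h
          · exact Or.inr ⟨i, by omega, (hrec i).1 h⟩

open Classical in
/-- The 0/1 vector whose ones are the positive places of `D + 1` signed columns. -/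
noncomputable def pattern (N : ℕ) (g : ℕ → ℕ → ℚ) (D : ℕ) (its : ℕ → ℕ → ℕ) (k : ℕ) : ℚ :=
  if ∃ i ≤ D, ItemPos N g D (its i) k then 1 else 0

theorem pattern_zero_or_one (N : ℕ) (g : ℕ → ℕ → ℚ) (D : ℕ) (its : ℕ → ℕ → ℕ) (k : ℕ) :
    pattern N g D its k = 0 ∨ pattern N g D its k = 1 := by
  unfold pattern; split_ifs <;> simp

theorem elim_congr (N : ℕ) (g : ℕ → ℕ → ℚ) {piv piv' : ℕ → ℕ × ℕ} {m : ℕ}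
    (h : ∀ k < m, piv k = piv' k) : elim N g piv m = elim N g piv' m := by
  induction m with
  | zero => rfl
  | succ m ih => rw [elim, elim, ih fun k hk => h k (by omega), h m (by omega)]

theorem pattern_congr (N : ℕ) (g : ℕ → ℕ → ℚ) {D : ℕ} {its its' : ℕ → ℕ → ℕ}
    (h : ∀ i ≤ D, ∀ q < 2 * D + 2, its i q = its' i q) :
    pattern N g D its = pattern N g D its' := by
  have h1 : ∀ i ≤ D, ∀ k, ItemPos N g D (its i) k ↔ ItemPos N g D (its' i) k := by
    intro i hi k
    have h2 : elim N g (pivots (its i)) D = elim N g (pivots (its' i)) D :=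
      elim_congr N g fun k hk => by
        simp only [pivots, h i hi (2 * k + 2) (by omega), h i hi (2 * k + 3) (by omega)]
    simp only [ItemPos, h2, h i hi 0 (by omega), h i hi 1 (by omega)]
  funext k
  unfold pattern
  classical
  exact if_congr (exists_congr fun i => and_congr_right fun hi => h1 i hi k) rfl rfl

theorem heightLe_elim {L N : ℕ} {g : ℕ → ℕ → ℚ} (hg : ∀ v u, RatRAM.HeightLe L (g v u))
    (piv : ℕ → ℕ × ℕ) (m k c : ℕ) : RatRAM.HeightLe (4 ^ m * L) (elim N g piv m k c) := by
  induction m generalizing k c with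
  | zero => simpa [elim] using hg k c
  | succ m ih =>
    simp only [elim, step]
    split_ifs
    · exact (((ih _ _).mul (ih _ _)).sub ((ih _ _).mul (ih _ _))).mono (by rw [pow_succ]; linarith)
    · exact (ih _ _).mono (by rw [pow_succ]; linarith [Nat.zero_le (4 ^ m * L)])

end PivotElim

/-! ### Optimal solutions with few ones -/

namespace BinaryQuadratic

variable {V : Type*} [Fintype V] [DecidableEq V]

/-- Twice the objective function `xᵀ U x + cᵀ x`, written with `M = U + Uᵀ`. -/
def val (M : Matrix V V ℚ) (c x : V → ℚ) : ℚ := x ⬝ᵥ (M *ᵥ x) + 2 * (c ⬝ᵥ x)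

theorem val_add_single (M : Matrix V V ℚ) (hM : M.IsSymm) (hd : ∀ v, M v v = 0) (c x : V → ℚ)
    (v : V) (t : ℚ) :
    val M c (x + Pi.single v t) = val M c x + 2 * t * (c v + (M *ᵥ x) v) := by
  have h1 : x ⬝ᵥ (M *ᵥ Pi.single v t) = t * (M *ᵥ x) v := by
    rw [Matrix.dotProduct_mulVec, dotProduct_single, ← Matrix.mulVec_transpose, hM.eq, mul_comm]
  have h2 : Pi.single v t ⬝ᵥ (M *ᵥ Pi.single v t) = 0 := by
    rw [single_dotProduct, Matrix.mulVec_single]; simp [hd]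
  simp only [val, Matrix.mulVec_add, add_dotProduct, dotProduct_add, h1, h2, single_dotProduct,
    dotProduct_single]
  ring

/-- Among the optimal solutions take one with as few ones as possible. Its ones are exactly the
places where the gradient `c + M x` is positive, as otherwise flipping one entry would help. -/
theorem exists_optimal (M : Matrix V V ℚ) (hM : M.IsSymm) (hd : ∀ v, M v v = 0) (c : V → ℚ) :
    ∃ x : V → ℚ, (∀ v, x v = if 0 < c v + (M *ᵥ x) v then 1 else 0) ∧
      ∀ y : V → ℚ, (∀ v, y v = 0 ∨ y v = 1) → val M c y ≤ val M c x := by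
  let ind : Finset V → V → ℚ := fun A v => if v ∈ A then 1 else 0
  obtain ⟨A₀, -, hA₀⟩ := Finset.exists_max_image Finset.univ (fun A => val M c (ind A))
    Finset.univ_nonempty
  obtain ⟨A, hA, hmin⟩ := Finset.exists_min_image
    (Finset.univ.filter fun A => val M c (ind A) = val M c (ind A₀)) Finset.card ⟨A₀, by simp⟩
  have hAval : val M c (ind A) = val M c (ind A₀) := by simpa using hA
  have hopt : ∀ B, val M c (ind B) ≤ val M c (ind A) := fun B => hAval ▸ hA₀ B (by simp)
  refine ⟨ind A, fun v => ?_, fun y hy => ?_⟩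
  · by_cases hv : v ∈ A
    · have hB : ind (A.erase v) = ind A + Pi.single v (-1) := by
        funext u
        by_cases hu : u = v
        · subst hu; simp [ind, hv]
        · simp [ind, hu]
      have h1 := val_add_single M hM hd c (ind A) v (-1)
      rw [← hB] at h1
      have h2 := hopt (A.erase v)
      have h3 : val M c (ind (A.erase v)) ≠ val M c (ind A) := by
        intro h
        have := hmin (A.erase v) (by simp [h, hAval])
        have := Finset.card_erase_lt_of_mem hv
        omega
      have h4 := lt_of_le_of_ne h2 h3
      rw [if_pos (by linarith)]
      simp [ind, hv]
    · have hB : ind (insert v A) = ind A + Pi.single v 1 := by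
        funext u
        by_cases hu : u = v
        · subst hu; simp [ind, hv]
        · simp [ind, hu]
      have h1 := val_add_single M hM hd c (ind A) v 1
      rw [← hB] at h1
      have h2 := hopt (insert v A)
      rw [if_neg (by linarith)]
      simp [ind, hv]
  · have : y = ind (Finset.univ.filter fun v => y v = 1) := by
      funext v
      rcases hy v with h | h <;> simp [ind, h]
    rw [this]; exact hopt _

end BinaryQuadratic

/-! ### The instance as a single matrix -/

namespace QuadInstance

open RatRAM

variable {s : ℕ}

/-- The number of variables. -/
def size (P : QuadInstance s) : ℕ := ∑ j, P.n j

/-- The numbering of all variables, block by block. -/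
def num (P : QuadInstance s) : (Σ j, Fin (P.n j)) ≃ Fin P.size := finSigmaFinEquiv

/-- The number of variables in the blocks before the block `m`. -/
def offset (P : QuadInstance s) (m : ℕ) : ℕ :=
  ∑ i ∈ Finset.range m, if h : i < s then P.n ⟨i, h⟩ else 0

theorem offset_self (P : QuadInstance s) : P.offset s = P.size := by
  simp [offset, size, Finset.sum_range]

theorem num_val (P : QuadInstance s) (j : Fin s) (k : Fin (P.n j)) :
    (P.num ⟨j, k⟩ : ℕ) = P.offset j + k := by
  refine (finSigmaFinEquiv_apply _).trans ?_
  rw [offset, Finset.sum_range]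
  congr 1
  refine Finset.sum_congr rfl fun i _ => ?_
  rw [dif_pos (i.2.trans j.2)]
  rfl

/-- The block of `U` at the position `(i, j)`: `Q^{i,j}` above the diagonal, and zero elsewhere. -/
def block (P : QuadInstance s) (i j : Fin s) : Matrix (Fin (P.n i)) (Fin (P.n j)) ℚ :=
  if h : i < j then P.Q i j h else 0

/-- The block matrix `U` of the quadratic part `xᵀ U x` of the objective. -/
def upper (P : QuadInstance s) : Matrix (Σ j, Fin (P.n j)) (Σ j, Fin (P.n j)) ℚ :=
  Matrix.of fun u v => P.block u.1 v.1 u.2 v.2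

/-- The matrix `M = U + Uᵀ`. -/
def sym (P : QuadInstance s) : Matrix (Σ j, Fin (P.n j)) (Σ j, Fin (P.n j)) ℚ :=
  P.upper + P.upperᵀ

/-- The vector of all linear coefficients. -/
def lin (P : QuadInstance s) : (Σ j, Fin (P.n j)) → ℚ := fun v => P.c v.1 v.2

theorem sym_isSymm (P : QuadInstance s) : P.sym.IsSymm := by
  simp [Matrix.IsSymm, sym, add_comm]

theorem sym_diag (P : QuadInstance s) (v) : P.sym v v = 0 := by
  simp [sym, upper, block]

theorem val_eq (P : QuadInstance s) (x : ∀ j, Fin (P.n j) → ℚ) :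
    BinaryQuadratic.val P.sym P.lin (fun v => x v.1 v.2) = 2 * P.obj x := by
  set y : (Σ j, Fin (P.n j)) → ℚ := fun v => x v.1 v.2
  have h1 : y ⬝ᵥ (P.upperᵀ *ᵥ y) = y ⬝ᵥ (P.upper *ᵥ y) := by
    rw [Matrix.mulVec_transpose, ← dotProduct_comm, Matrix.dotProduct_mulVec]
  have h2 : y ⬝ᵥ (P.upper *ᵥ y) =
      ∑ i, ∑ j, if h : i < j then x i ⬝ᵥ (P.Q i j h *ᵥ x j) else 0 := by
    simp only [dotProduct, Matrix.mulVec, Fintype.sum_sigma, upper, Matrix.of_apply, y]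
    refine Finset.sum_congr rfl fun i _ => ?_
    simp only [Finset.mul_sum]
    rw [Finset.sum_comm]
    refine Finset.sum_congr rfl fun j _ => ?_
    by_cases h : i < j
    · simp [block, h]
    · simp [block, h]
  have h3 : P.lin ⬝ᵥ y = ∑ j, P.c j ⬝ᵥ x j := by
    simp [dotProduct, Fintype.sum_sigma, lin, y]
  rw [BinaryQuadratic.val, sym, Matrix.add_mulVec, dotProduct_add, h1, h2, h3, obj]
  ring

theorem rank_add_le {V W : Type*} [Fintype V] [Fintype W] (A B : Matrix V W ℚ) :
    (A + B).rank ≤ A.rank + B.rank := by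
  have h : LinearMap.range (A + B).mulVecLin ≤
      LinearMap.range A.mulVecLin ⊔ LinearMap.range B.mulVecLin := by
    rw [Matrix.mulVecLin_add]
    rintro _ ⟨x, rfl⟩
    exact Submodule.add_mem_sup ⟨x, rfl⟩ ⟨x, rfl⟩
  exact (Submodule.finrank_mono h).trans (Submodule.finrank_add_le_finrank_add_finrank _ _)

theorem rank_upper_le (P : QuadInstance s) {r : ℕ}
    (hr : ∀ (i j : Fin s) (h : i < j), (P.Q i j h).rank ≤ r) : P.upper.rank ≤ s * s * r := by
  -- `E i` places a block of coordinates among all coordinates.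
  let E : ∀ i : Fin s, Matrix (Σ j, Fin (P.n j)) (Fin (P.n i)) ℚ := fun i =>
    Matrix.of fun v k => if v = ⟨i, k⟩ then 1 else 0
  have hsum : P.upper = ∑ p : Fin s × Fin s, E p.1 * P.block p.1 p.2 * (E p.2)ᵀ := by
    ext ⟨i, k⟩ ⟨j, l⟩
    rw [Fintype.sum_prod_type, Matrix.sum_apply, Finset.sum_eq_single i, Matrix.sum_apply,
      Finset.sum_eq_single j]
    · simp [E, Matrix.mul_apply, upper]
    · intro b _ hb
      rw [Matrix.mul_apply]
      refine Finset.sum_eq_zero fun q _ => ?_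
      simp [E, hb.symm]
    · simp
    · intro b _ hb
      rw [Matrix.sum_apply]
      refine Finset.sum_eq_zero fun q _ => ?_
      rw [Matrix.mul_apply]
      refine Finset.sum_eq_zero fun q' _ => ?_
      simp [E, Matrix.mul_apply, hb.symm]
    · simp
  have hle : ∀ S : Finset (Fin s × Fin s),
      (∑ p ∈ S, E p.1 * P.block p.1 p.2 * (E p.2)ᵀ).rank ≤ S.card * r := by
    intro S
    induction S using Finset.induction_on with
    | empty => simp
    | insert p S hp ih =>
      rw [Finset.sum_insert hp, Finset.card_insert_of_notMem hp, Nat.succ_mul]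
      refine (rank_add_le _ _).trans ((add_le_add ?_ ih).trans_eq (add_comm r _))
      refine (Matrix.rank_mul_le_left _ _).trans ((Matrix.rank_mul_le_right _ _).trans ?_)
      unfold block
      split_ifs with h
      · exact hr _ _ h
      · simp
  have := hle Finset.univ
  rw [← hsum] at this
  simpa using this

/-- The matrix `[M | c]` with rows and columns numbered by natural numbers: the column `size` is
`c`. -/
def table (P : QuadInstance s) (v u : ℕ) : ℚ :=
  if hv : v < P.size then
    if hu : u < P.size then P.sym (P.num.symm ⟨v, hv⟩) (P.num.symm ⟨u, hu⟩)
    else P.lin (P.num.symm ⟨v, hv⟩)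
  else 0

theorem gradient_mem (P : QuadInstance s) (x : (Σ j, Fin (P.n j)) → ℚ) :
    (fun v : Fin P.size => (P.lin + P.sym *ᵥ x) (P.num.symm v)) ∈
      PivotElim.colSpace P.size P.table := by
  have h : (fun v : Fin P.size => (P.lin + P.sym *ᵥ x) (P.num.symm v)) =
      PivotElim.col P.size P.table P.size +
        ∑ u : Fin P.size, x (P.num.symm u) • PivotElim.col P.size P.table u := by
    funext v
    simp only [Pi.add_apply, Matrix.mulVec, dotProduct, Finset.sum_apply, Pi.smul_apply,
      smul_eq_mul, PivotElim.col, table, lt_irrefl, Fin.is_lt, dite_true, dite_false, Fin.eta]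
    rw [← P.num.symm.sum_comp]
    simp [mul_comm]
  rw [h]
  refine Submodule.add_mem _ (Submodule.subset_span ⟨_, Set.mem_Iic.2 le_rfl, rfl⟩)
    (Submodule.sum_mem _ fun u _ => Submodule.smul_mem _ _ (Submodule.subset_span ⟨_, ?_, rfl⟩))
  exact u.2.le

theorem finrank_colSpace_le (P : QuadInstance s) {r : ℕ}
    (hr : ∀ (i j : Fin s) (h : i < j), (P.Q i j h).rank ≤ r) :
    Module.finrank ℚ (PivotElim.colSpace P.size P.table) ≤ 2 * (s * s * r) + 1 := by
  let M' : Matrix (Fin P.size) (Fin P.size) ℚ := P.sym.submatrix P.num.symm P.num.symm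
  have hle : PivotElim.colSpace P.size P.table ≤
      LinearMap.range M'.mulVecLin ⊔ Submodule.span ℚ {PivotElim.col P.size P.table P.size} := by
    rw [PivotElim.colSpace, Submodule.span_le]
    rintro _ ⟨u, hu, rfl⟩
    rcases (Set.mem_Iic.1 hu).lt_or_eq with h | rfl
    · refine Submodule.mem_sup_left ⟨Pi.single ⟨u, h⟩ 1, ?_⟩
      funext v
      simp [PivotElim.col, table, M', h]
    · exact Submodule.mem_sup_right (Submodule.mem_span_singleton_self _)
  have h1 : Module.finrank ℚ (LinearMap.range M'.mulVecLin) ≤ s * s * r + s * s * r := by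
    change M'.rank ≤ _
    rw [Matrix.rank_submatrix]
    refine (rank_add_le _ _).trans (add_le_add (P.rank_upper_le hr) ?_)
    rw [Matrix.rank_transpose]
    exact P.rank_upper_le hr
  have h2 := finrank_span_le_card (R := ℚ) ({PivotElim.col P.size P.table P.size} : Set _)
  have h3 := Submodule.finrank_mono hle
  have h4 := Submodule.finrank_add_le_finrank_add_finrank (LinearMap.range M'.mulVecLin)
    (Submodule.span ℚ {PivotElim.col P.size P.table P.size})
  simp at h2
  omega

/-- Twice the objective function, as a double sum over the table. The vector `x` is continued by
the entry `2`, which meets the column of `c`. -/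
theorem two_mul_obj_eq_sum (P : QuadInstance s) (X : ℕ → ℚ) (hX : X P.size = 2) :
    2 * P.obj (fun j k => X (P.num ⟨j, k⟩)) =
      ∑ v ∈ Finset.range P.size, ∑ u ∈ Finset.range (P.size + 1), P.table v u * X v * X u := by
  rw [← P.val_eq, BinaryQuadratic.val, Finset.sum_range]
  simp only [Finset.sum_range_succ, Finset.sum_add_distrib, hX]
  congr 1
  · simp only [dotProduct, Matrix.mulVec]
    rw [← P.num.symm.sum_comp]
    refine Finset.sum_congr rfl fun v _ => ?_
    rw [← P.num.symm.sum_comp, Finset.mul_sum, Finset.sum_range]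
    refine Finset.sum_congr rfl fun u _ => ?_
    simp [table]; ring
  · simp only [dotProduct]
    rw [← P.num.symm.sum_comp, Finset.mul_sum]
    refine Finset.sum_congr rfl fun v _ => ?_
    simp [table]; ring

/-- An optimal solution is either zero or the positive part of a sign pattern given by `D + 1`
signed columns of the table after elimination. -/
theorem exists_optimal_pattern (P : QuadInstance s) {D : ℕ} (h0 : 0 < P.size)
    (hD : Module.finrank ℚ (PivotElim.colSpace P.size P.table) ≤ D + 1) :
    ∃ x : ∀ j, Fin (P.n j) → ℚ, P.IsOptimal x ∧ ((∀ j k, x j k = 0) ∨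
      ∃ its : ℕ → ℕ → ℕ, (∀ i q, its i q ≤ P.size) ∧ 
        ∀ j k, x j k = PivotElim.pattern P.size P.table D its (P.num ⟨j, k⟩)) := by
  obtain ⟨x, hx, hopt⟩ := BinaryQuadratic.exists_optimal P.sym P.sym_isSymm P.sym_diag P.lin
  refine ⟨fun j k => x ⟨j, k⟩, ⟨fun j k => ?_, fun y hy => ?_⟩, ?_⟩
  · change x ⟨j, k⟩ = 0 ∨ x ⟨j, k⟩ = 1
    rw [hx]; split_ifs <;> simp
  · have h1 := hopt (fun v => y v.1 v.2) fun v => hy v.1 v.2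
    rw [P.val_eq] at h1
    have h2 := P.val_eq fun j k => x ⟨j, k⟩
    change BinaryQuadratic.val P.sym P.lin x = _ at h2
    linarith
  · set f : Fin P.size → ℚ := fun v => (P.lin + P.sym *ᵥ x) (P.num.symm v)
    have hxf : ∀ j k, x ⟨j, k⟩ = if 0 < f (P.num ⟨j, k⟩) then 1 else 0 := by
      intro j k; rw [hx]; simp [f]
    by_cases hf : f = 0
    · left; intro j k; exact (hxf j k).trans (by simp [hf])
    · obtain ⟨its, h1, h2⟩ := PivotElim.exists_items h0 D P.table f hD (P.gradient_mem x) hf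
      refine .inr ⟨its, h1, fun j k => (hxf j k).trans ?_⟩
      rw [PivotElim.pattern]
      classical
      exact if_congr (h2 _) rfl rfl

theorem one_le_ratSize (q : ℚ) : 1 ≤ ratSize q := by unfold ratSize; omega

theorem dim_le_bitSize (P : QuadInstance s) : P.dim ≤ P.bitSize := by
  refine add_le_add (Finset.sum_le_sum fun i _ => Finset.sum_le_sum fun j _ => ?_)
    (Finset.sum_le_sum fun j _ => ?_)
  · split_ifs with h
    · calc P.n i * P.n j = ∑ k : Fin (P.n i), ∑ l : Fin (P.n j), 1 := by simp
        _ ≤ _ := Finset.sum_le_sum fun k _ => Finset.sum_le_sum fun l _ => one_le_ratSize _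
    · exact le_rfl
  · calc P.n j = ∑ k : Fin (P.n j), 1 := by simp
      _ ≤ _ := Finset.sum_le_sum fun k _ => one_le_ratSize _

theorem size_le_dim (P : QuadInstance s) : P.size ≤ P.dim := Nat.le_add_left _ _

theorem ratSize_Q_le (P : QuadInstance s) {i j : Fin s} (h : i < j) (k l) :
    ratSize (P.Q i j h k l) ≤ P.bitSize := by
  refine le_trans ?_ (Nat.le_add_right _ _)
  have h1 := Finset.single_le_sum (f := fun i => ∑ j, if h : i < j then
    ∑ k, ∑ l, ratSize (P.Q i j h k l) else 0) (fun _ _ => Nat.zero_le _) (Finset.mem_univ i)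
  refine le_trans ?_ h1
  have h2 := Finset.single_le_sum (f := fun j => if h : i < j then
    ∑ k, ∑ l, ratSize (P.Q i j h k l) else 0) (fun _ _ => Nat.zero_le _) (Finset.mem_univ j)
  refine le_trans ?_ h2
  simp only [h, dite_true]
  exact (Finset.single_le_sum (f := fun l => ratSize (P.Q i j h k l))
    (fun _ _ => Nat.zero_le _) (Finset.mem_univ l)).trans
    (Finset.single_le_sum (f := fun k => ∑ l, ratSize (P.Q i j h k l))
    (fun _ _ => Nat.zero_le _) (Finset.mem_univ k))

theorem ratSize_c_le (P : QuadInstance s) (j : Fin s) (k) : ratSize (P.c j k) ≤ P.bitSize := by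
  refine le_trans ?_ (Nat.le_add_left _ _)
  exact (Finset.single_le_sum (f := fun k => ratSize (P.c j k))
    (fun _ _ => Nat.zero_le _) (Finset.mem_univ k)).trans
    (Finset.single_le_sum (f := fun j => ∑ k, ratSize (P.c j k))
    (fun _ _ => Nat.zero_le _) (Finset.mem_univ j))

theorem sym_of_lt (P : QuadInstance s) {i j : Fin s} (h : i < j) (k l) :
    P.sym ⟨i, k⟩ ⟨j, l⟩ = P.Q i j h k l := by
  simp [sym, upper, block, h, h.not_gt]

theorem sym_of_gt (P : QuadInstance s) {i j : Fin s} (h : i < j) (k l) :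
    P.sym ⟨j, l⟩ ⟨i, k⟩ = P.Q i j h k l := by
  simp [sym, upper, block, h, h.not_gt]

theorem heightLe_table (P : QuadInstance s) (v u : ℕ) : HeightLe P.bitSize (P.table v u) := by
  have hz : HeightLe P.bitSize 0 := heightLe_zero.mono (Nat.zero_le _)
  unfold table
  split_ifs with hv hu
  · generalize P.num.symm ⟨v, hv⟩ = a
    generalize P.num.symm ⟨u, hu⟩ = b
    obtain ⟨i, k⟩ := a
    obtain ⟨j, l⟩ := b
    rcases lt_trichotomy i j with h | rfl | h
    · rw [P.sym_of_lt h]; exact (heightLe_ratSize _).mono (P.ratSize_Q_le h _ _)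
    · simpa [sym, upper, block] using hz
    · rw [P.sym_of_gt h]; exact (heightLe_ratSize _).mono (P.ratSize_Q_le h _ _)
  · exact (heightLe_ratSize _).mono (P.ratSize_c_le _ _)
  · exact hz

end QuadInstance

/-! ### The search program -/

namespace QuadInstance

open RatRAM PivotElim

variable {s : ℕ}

/-- Scratch register. -/
abbrev rTmp : Reg s := .work 0
/-- Holds the number `N` of variables. -/
abbrev rN : Reg s := .work 1
/-- Holds the row length `N + 1` of the table. -/
abbrev rW : Reg s := .work 2
/-- Loop counter, mostly for the rows of the table. -/
abbrev rV : Reg s := .work 3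
/-- Loop counter, mostly for the columns of the table. -/
abbrev rU : Reg s := .work 4
/-- The `q`-th entry of the `i`-th signed column that is being tried. -/
abbrev rItem (i q : ℕ) : Reg s := .work (2 * Nat.pair i q + 11)

/-- The table, row by row. -/
abbrev aTable : Arr s := .work 0
/-- Stack for the evaluation of expressions. -/
abbrev aStack : Arr s := .work 1
/-- The present candidate. -/
abbrev aCand : Arr s := .work 2
/-- The best solution found so far. -/
abbrev aBest : Arr s := .work 3
/-- Cell `0` holds twice the objective value of the candidate, cell `1` that of the best
solution. -/
abbrev aVal : Arr s := .work 4

/-- The bounds that the numbers of the instance satisfy, where `N` is the number of variables, `D`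
the number of elimination steps, `L` bounds the heights of the entries of the table, and `B` is the
admissible encoding length. -/
structure Bounds (N D L B : ℕ) (g : ℕ → ℕ → ℚ) : Prop where
  height : ∀ v u, HeightLe L (g v u)
  elim_le : 2 * (4 ^ D * L) + 3 ≤ B
  sum_le : 2 * (N * (N + 1) * (L + 4)) + 3 ≤ B
  idx_le : (N + 1) * (N + 1) + 7 ≤ B

/-- The table has been loaded. -/
structure Loaded (N : ℕ) (g : ℕ → ℕ → ℚ) (σ : State (Reg s) (Arr s)) : Prop where
  idx_N : σ.idx rN = N
  idx_W : σ.idx rW = N + 1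
  table : ∀ v < N, ∀ u ≤ N, σ.arr aTable (v * (N + 1) + u) = g v u

theorem Loaded.of_eq {N : ℕ} {g : ℕ → ℕ → ℚ} {σ τ : State (Reg s) (Arr s)} (h : Loaded N g σ)
    (h1 : τ.idx rN = σ.idx rN) (h2 : τ.idx rW = σ.idx rW) (h3 : τ.arr aTable = σ.arr aTable) :
    Loaded N g τ :=
  ⟨h1.trans h.1, h2.trans h.2, fun v hv u hu => by rw [h3]; exact h.3 v hv u hu⟩

theorem address_lt {N v u : ℕ} (hv : v < N) (hu : u ≤ N) : v * (N + 1) + u < N * (N + 1) := by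
  have := Nat.mul_le_mul_right (N + 1) (Nat.succ_le_of_lt hv)
  rw [Nat.succ_mul] at this
  omega

/-- Evaluates the entry of the matrix after `m` elimination steps in the row held by the register
`k` and the column held by the register `c`, following the recursion for `elim`. The result goes to
cell `t` of the stack, and only the cells from `t` on are used. -/
def evalElim (it : ℕ → Reg s) : ℕ → Reg s → Reg s → ℕ → Prog (Reg s) (Arr s)
  | 0, k, c, t => .seq (.idxArith .mul rTmp k rW) (.seq (.idxArith .add rTmp rTmp c)
      (.ratCopy (.direct aStack t) (.indirect aTable rTmp)))
  | m + 1, k, c, t => .seq (evalElim it m k c t) (.ite (.idxLt (it (2 * m + 2)) rN)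
      (.seq (evalElim it m (it (2 * m + 2)) (it (2 * m + 3)) (t + 1))
      (.seq (.ratArith .mul (.direct aStack t) (.direct aStack t) (.direct aStack (t + 1)))
      (.seq (evalElim it m k (it (2 * m + 3)) (t + 1))
      (.seq (evalElim it m (it (2 * m + 2)) c (t + 2))
      (.seq (.ratArith .mul (.direct aStack (t + 1)) (.direct aStack (t + 1))
        (.direct aStack (t + 2)))
      (.ratArith .sub (.direct aStack t) (.direct aStack t) (.direct aStack (t + 1))))))))
      .skip)

theorem writesIdx_evalElim (it : ℕ → Reg s) (m : ℕ) (k c : Reg s) (t : ℕ) {i : Reg s}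
    (h : (evalElim it m k c t).WritesIdx i) : i = rTmp := by
  induction m generalizing k c t with
  | zero => simpa [evalElim, Prog.WritesIdx] using h
  | succ m ih =>
    simp only [evalElim, Prog.WritesIdx, or_false, false_or] at h
    rcases h with h | h | h | h <;> exact ih _ _ _ h

theorem writesArr_evalElim (it : ℕ → Reg s) (m : ℕ) (k c : Reg s) (t : ℕ) {a : Arr s}
    (h : (evalElim it m k c t).WritesArr a) : a = aStack := by
  induction m generalizing k c t with
  | zero => simpa [evalElim, Prog.WritesArr, Ref.name] using h
  | succ m ih =>
    simp only [evalElim, Prog.WritesArr, or_false, Ref.name] at h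
    rcases h with h | h | h | h | h | h | h <;> first | exact h | exact ih _ _ _ h

/-- The running time of `evalElim`. -/
def elimTime : ℕ → ℕ
  | 0 => 3
  | m + 1 => 4 * elimTime m + 4

theorem total_evalElim {N D L B : ℕ} {g : ℕ → ℕ → ℚ} (hB : Bounds N D L B g) (it : ℕ → Reg s)
    (hit : ∀ q, it q ≠ rTmp) (m : ℕ) (hm : m ≤ D) {k c : Reg s} (hk : k ≠ rTmp) (hc : c ≠ rTmp)
    (t : ℕ) {σ : State (Reg s) (Arr s)} (hσ : Loaded N g σ) (hkN : σ.idx k < N)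
    (hcN : σ.idx c ≤ N) (hitN : ∀ q < 2 * m + 2, σ.idx (it q) ≤ N) :
    Total B (elimTime m) (evalElim it m k c t) σ fun τ =>
      (τ.arr aStack t = elim N g (pivots fun q => σ.idx (it q)) m (σ.idx k) (σ.idx c) ∧
        ∀ t' < t, τ.arr aStack t' = σ.arr aStack t') ∧
      (∀ i, i ≠ rTmp → τ.idx i = σ.idx i) ∧ (∀ a, a ≠ aStack → τ.arr a = σ.arr a) := by
  suffices h : Total B (elimTime m) (evalElim it m k c t) σ fun τ =>
      τ.arr aStack t = elim N g (pivots fun q => σ.idx (it q)) m (σ.idx k) (σ.idx c) ∧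
        ∀ t' < t, τ.arr aStack t' = σ.arr aStack t' from
    h.frame.imp fun τ h => ⟨h.1, fun i hi => h.2.1 i fun h => hi (writesIdx_evalElim _ _ _ _ _ h),
      fun a ha => h.2.2 a fun h => ha (writesArr_evalElim _ _ _ _ _ h)⟩
  induction m generalizing k c t σ with
  | zero =>
    have h1 : σ.idx k * σ.idx rW + σ.idx c < N * (N + 1) := by
      rw [hσ.idx_W]; exact address_lt hkN hcN
    have h2 := hB.idx_le
    have h3 : N * (N + 1) ≤ (N + 1) * (N + 1) := Nat.mul_le_mul_right _ (Nat.le_succ _)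
    refine (Total.seq (Total.idxArith ?_ (Total.seq (Total.idxArith ?_
      (Total.ratCopy ?_ ⟨?_, ?_⟩))))).mono le_rfl fun _ h => h
    · simp only [IdxOp.eval]; omega
    · simp [IdxOp.eval, hc]; omega
    · simp only [State.get, Ref.name, Ref.pos, State.setIdx_idx, State.setIdx_arr, IdxOp.eval,
        if_true, if_neg hc]
      rw [hσ.idx_W, hσ.table _ hkN _ hcN]
      refine ((hB.height _ _).ratSize_le).trans (le_trans ?_ hB.elim_le)
      have := Nat.le_mul_of_pos_left L (Nat.pow_pos (n := D) (show 0 < 4 by norm_num))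
      omega
    · simp only [State.set_arr, State.get, Ref.name, Ref.pos, State.setIdx_idx, State.setIdx_arr,
        IdxOp.eval, if_true, if_neg hc, and_self]
      rw [hσ.idx_W, hσ.table _ hkN _ hcN]; rfl
    · intro t' ht'
      simp [State.set_arr, Ref.name, Ref.pos, ht'.ne]
  | succ m ih =>
    set piv := pivots fun q => σ.idx (it q)
    have hm' : m ≤ D := by omega
    have hpow : 4 ^ (m + 1) * L ≤ 4 ^ D * L :=
      Nat.mul_le_mul_right _ (Nat.pow_le_pow_right (by norm_num) hm)
    have hsize : ∀ q, HeightLe (4 ^ (m + 1) * L) q → ratSize q ≤ B := fun q hq =>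
      hq.ratSize_le.trans (le_trans (by omega) hB.elim_le)
    have hE := heightLe_elim (N := N) hB.height piv m
    have hprod : ∀ k c k' c',
        HeightLe (4 ^ (m + 1) * L) (elim N g piv m k c * elim N g piv m k' c') :=
      fun k c k' c' => ((hE k c).mul (hE k' c')).mono (by
        rw [pow_succ]; linarith [Nat.zero_le (4 ^ m * L)])
    -- Evaluation in a state that differs only in the scratch register and in the stack.
    have ev : ∀ (k c : Reg s) (t : ℕ) (ρ : State (Reg s) (Arr s)), k ≠ rTmp → c ≠ rTmp →
        σ.idx k < N → σ.idx c ≤ N → (∀ i, i ≠ rTmp → ρ.idx i = σ.idx i) →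
        (∀ a, a ≠ aStack → ρ.arr a = σ.arr a) →
        Total B (elimTime m) (evalElim it m k c t) ρ fun τ =>
          τ.arr aStack t = elim N g piv m (σ.idx k) (σ.idx c) ∧
          (∀ t' < t, τ.arr aStack t' = ρ.arr aStack t') ∧
          (∀ i, i ≠ rTmp → τ.idx i = σ.idx i) ∧ (∀ a, a ≠ aStack → τ.arr a = σ.arr a) := by
      intro k c t ρ hk hc hkN hcN h1 h2
      have hρ : Loaded N g ρ := hσ.of_eq (h1 _ (by simp)) (h1 _ (by simp)) (h2 _ (by simp))
      have := ih hm' (k := k) (c := c) hk hc t hρ (by rwa [h1 k hk]) (by rwa [h1 c hc])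
        fun q hq => by rw [h1 _ (hit q)]; exact hitN q (by omega)
      have hp : (pivots fun q => ρ.idx (it q)) = piv := by
        simp only [h1 _ (hit _)]; rfl
      rw [hp, h1 k hk, h1 c hc] at this
      refine this.frame.imp fun τ h => ⟨h.1.1, h.1.2, fun i hi => ?_, fun a ha => ?_⟩
      · rw [h.2.1 i fun h => hi (writesIdx_evalElim _ _ _ _ _ h), h1 i hi]
      · rw [h.2.2 a fun h => ha (writesArr_evalElim _ _ _ _ _ h), h2 a ha]
    have hcol : σ.idx (it (2 * m + 3)) ≤ N := hitN _ (by omega)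
    have htime : elimTime m + (1 + (elimTime m + (1 + (elimTime m + (elimTime m + (1 + 1)))))) ≤
        elimTime (m + 1) := by
      rw [elimTime]; omega
    refine Total.mono
      (Total.seq ((ev k c t σ hk hc hkN hcN (fun _ _ => rfl) fun _ _ => rfl).imp ?_))
      htime fun _ h => h
    rintro ρ₁ ⟨e1, s1, i1, a1⟩
    refine Total.ite (fun hr => ?_) fun hr => ?_
    · simp only [Test.Holds, i1 _ (hit _), i1 rN (by simp), hσ.idx_N] at hr
      have hstep : elim N g piv (m + 1) (σ.idx k) (σ.idx c) =
          elim N g piv m (σ.idx k) (σ.idx c) *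
            elim N g piv m (σ.idx (it (2 * m + 2))) (σ.idx (it (2 * m + 3))) -
          elim N g piv m (σ.idx k) (σ.idx (it (2 * m + 3))) *
            elim N g piv m (σ.idx (it (2 * m + 2))) (σ.idx c) := by
        rw [elim, step]; exact if_pos hr
      refine Total.seq ((ev (it (2 * m + 2)) (it (2 * m + 3)) (t + 1) ρ₁ (hit _) (hit _) hr hcol
        i1 a1).imp ?_)
      rintro ρ₂ ⟨e2, s2, i2, a2⟩
      refine Total.seq (Total.ratArith (by simp) ?_ ?_)
      · simp only [State.get, Ref.name, Ref.pos, RatOp.eval, e2, s2 t (by omega), e1]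
        exact hsize _ (hprod _ _ _ _)
      refine Total.seq ((ev k (it (2 * m + 3)) (t + 1) _ hk (hit _) hkN hcol
        (fun i hi => by simpa using i2 i hi)
        (fun a ha => (State.set_arr_of_ne _ _ _ ha).trans (a2 a ha))).imp ?_)
      rintro ρ₃ ⟨e3, s3, i3, a3⟩
      refine Total.seq ((ev (it (2 * m + 2)) c (t + 2) ρ₃ (hit _) hc hr hcN i3 a3).imp ?_)
      rintro ρ₄ ⟨e4, s4, i4, a4⟩
      have et : ρ₄.arr aStack t = elim N g piv m (σ.idx k) (σ.idx c) *
          elim N g piv m (σ.idx (it (2 * m + 2))) (σ.idx (it (2 * m + 3))) := by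
        rw [s4 t (by omega), s3 t (by omega)]
        simp [State.set_arr, State.get, Ref.name, Ref.pos, RatOp.eval, e2, s2 t (by omega), e1]
      have et1 := (s4 (t + 1) (by omega)).trans e3
      refine Total.seq (Total.ratArith (by simp) ?_ (Total.ratArith (by simp) ?_ ⟨?_, ?_⟩))
      · simp only [State.get, Ref.name, Ref.pos, RatOp.eval, e4, et1]
        exact hsize _ (hprod _ _ _ _)
      · simp only [State.get, Ref.name, Ref.pos, RatOp.eval, State.set_arr, e4, et, et1]
        simp only [Nat.ne_of_lt (Nat.lt_succ_self t), and_false, if_false, and_self, if_true]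
        rw [← hstep]
        exact hsize _ (heightLe_elim hB.height _ _ _ _)
      · simp only [State.get, Ref.name, Ref.pos, RatOp.eval, State.set_arr, e4, et, et1]
        simp only [Nat.ne_of_lt (Nat.lt_succ_self t), and_false, if_false, and_self, if_true]
        rw [hstep]
      · intro t' ht'
        simp only [State.set_arr, Ref.name, Ref.pos, ht'.ne, show t' ≠ t + 1 by omega, and_false,
          if_false]
        rw [s4 t' (by omega), s3 t' (by omega)]
        simp only [State.set_arr, Ref.name, Ref.pos, ht'.ne, and_false, if_false]
        rw [s2 t' (by omega), s1 t' ht']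
    · simp only [Test.Holds, i1 _ (hit _), i1 rN (by simp), hσ.idx_N] at hr
      refine (Total.skip ⟨?_, s1⟩).mono (by omega) fun _ h => h
      rw [e1, elim, step]
      exact (if_neg hr).symm

/-- If the `i`-th signed column is positive in the row `rV`, sets that entry of the candidate to
`1`. -/
def setBit (D i : ℕ) : Prog (Reg s) (Arr s) :=
  .seq (evalElim (rItem i) D rV (rItem i 1) 0) (.seq (.ratConst (.direct aStack 1) 0)
    (.seq (.idxConst rTmp 0) (.ite (.idxEq (rItem i 0) rTmp)
      (.ite (.ratLt (.direct aStack 1) (.direct aStack 0)) (.ratConst (.indirect aCand rV) 1) .skip)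
      (.ite (.ratLt (.direct aStack 0) (.direct aStack 1)) (.ratConst (.indirect aCand rV) 1)
        .skip))))

theorem writesIdx_setBit (D i : ℕ) {x : Reg s} (h : (setBit D i).WritesIdx x) : x = rTmp := by
  simp only [setBit, Prog.WritesIdx, or_false, false_or] at h
  exact h.elim (writesIdx_evalElim _ _ _ _ _) id

theorem writesArr_setBit (D i : ℕ) {a : Arr s} (h : (setBit D i).WritesArr a) :
    a = aStack ∨ a = aCand := by
  simp only [setBit, Prog.WritesArr, or_false, false_or, Ref.name] at h
  rcases h with h | h | h | h
  · exact .inl (writesArr_evalElim _ _ _ _ _ h)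
  · exact .inl h
  · exact .inr h
  · exact .inr h

/-- The registers that hold the signed columns have admissible values. -/
def ItemsLe (N D : ℕ) (σ : State (Reg s) (Arr s)) : Prop :=
  ∀ i ≤ D, ∀ q < 2 * D + 2, σ.idx (rItem i q) ≤ N

/-- The signed columns that are being tried. -/
abbrev items (σ : State (Reg s) (Arr s)) (i q : ℕ) : ℕ := σ.idx (rItem i q)

theorem items_eq {σ τ : State (Reg s) (Arr s)} (h : ∀ i q, τ.idx (rItem i q) = σ.idx (rItem i q)) :
    items τ = items σ := by
  funext i q; exact h i q

theorem ItemsLe.of_eq {N D : ℕ} {σ τ : State (Reg s) (Arr s)} (h : ItemsLe N D σ)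
    (h' : items τ = items σ) : ItemsLe N D τ := fun i hi q hq =>
  (congrFun (congrFun h' i) q).trans_le (h i hi q hq)

section

variable {N D L B : ℕ} {g : ℕ → ℕ → ℚ} {σ : State (Reg s) (Arr s)}

theorem Bounds.ratSize_zero_le (hB : Bounds N D L B g) : ratSize 0 ≤ B :=
  heightLe_zero.ratSize_le.trans (by have := hB.idx_le; omega)

theorem Bounds.ratSize_one_le (hB : Bounds N D L B g) : ratSize 1 ≤ B :=
  heightLe_one.ratSize_le.trans (by have := hB.idx_le; omega)

theorem Bounds.ratSize_two_le (hB : Bounds N D L B g) : ratSize 2 ≤ B :=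
  heightLe_two.ratSize_le.trans (by have := hB.idx_le; omega)

theorem Bounds.lt (hB : Bounds N D L B g) : N + 1 < B := by
  have := hB.idx_le
  have := Nat.le_mul_self (N + 1)
  omega

theorem total_setBit (hB : Bounds N D L B g) {i : ℕ} (hi : i ≤ D) (hσ : Loaded N g σ)
    (hit : ItemsLe N D σ) {v : ℕ} (hv : σ.idx rV = v) (hvN : v < N) :
    Total B (elimTime D + 5) (setBit D i) σ fun τ =>
      (ItemPos N g D (items σ i) v → τ.arr aCand v = 1) ∧
      (¬ ItemPos N g D (items σ i) v → τ.arr aCand v = σ.arr aCand v) ∧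
      ∀ k ≠ v, τ.arr aCand k = σ.arr aCand k := by
  refine Total.mono (Total.seq ((total_evalElim hB (rItem i) (by simp) D le_rfl (by simp) (by simp)
    0 hσ (by rwa [hv]) (hit i hi 1 (by omega)) (hit i hi)).imp ?_))
    (show elimTime D + (1 + (1 + (1 + (1 + 1)))) ≤ elimTime D + 5 by omega) fun _ h => h
  rintro ρ ⟨⟨h1, -⟩, h2, h3⟩
  refine Total.seq (Total.ratConst hB.ratSize_zero_le
    (Total.seq (Total.idxConst (Nat.zero_le _) ?_)))
  have hc := h3 aCand (by simp)
  rw [hv] at h1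
  have hw : ∀ (θ : State (Reg s) (Arr s)) (b : Test (Reg s) (Arr s)), θ.idx rV = v →
      θ.arr aCand = σ.arr aCand → (b.Holds θ ↔ ItemPos N g D (items σ i) v) →
      Total B (1 + 1) (.ite b (.ratConst (.indirect aCand rV) 1) .skip) θ fun τ =>
        (ItemPos N g D (items σ i) v → τ.arr aCand v = 1) ∧
        (¬ ItemPos N g D (items σ i) v → τ.arr aCand v = σ.arr aCand v) ∧
        ∀ k ≠ v, τ.arr aCand k = σ.arr aCand k := by
    intro θ b hθ hθ' hb
    refine Total.ite (fun h => Total.ratConst hB.ratSize_one_le ?_) fun h => Total.skip ?_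
    · have hpos := hb.1 h
      simp +contextual [State.set_arr, Ref.name, Ref.pos, hθ, hθ', hpos]
    · have hpos : ¬ ItemPos N g D (items σ i) v := fun h' => h (hb.2 h')
      simp [hpos, hθ']
  have hv' : ρ.idx rV = v := (h2 _ (by simp)).trans hv
  have h0 : ρ.idx (rItem i 0) = items σ i 0 := h2 _ (by simp)
  have hcand : (State.set ρ (.direct aStack 1) 0).arr aCand = σ.arr aCand :=
    (State.set_arr_of_ne _ _ _ (by simp [Ref.name])).trans hc
  refine Total.ite (fun h => ?_) fun h => ?_
  · refine hw _ _ (by simpa using hv') hcand ?_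
    simp only [Test.Holds, State.setIdx_idx, State.set_idx, h0] at h
    simp at h
    simp [Test.Holds, State.get, Ref.name, Ref.pos, State.set_arr, h1, ItemPos, h]
  · refine hw _ _ (by simpa using hv') hcand ?_
    simp only [Test.Holds, State.setIdx_idx, State.set_idx, h0] at h
    simp at h
    simp [Test.Holds, State.get, Ref.name, Ref.pos, State.set_arr, h1, ItemPos, h]

/-- Computes the entry of the candidate in the row `rV`. -/
def setRow (D : ℕ) : Prog (Reg s) (Arr s) :=
  .seq (.ratConst (.indirect aCand rV) 0) (seqList ((List.range (D + 1)).map (setBit D)))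

theorem writesIdx_setRow (D : ℕ) {x : Reg s} (h : (setRow D).WritesIdx x) : x = rTmp := by
  simp only [setRow, Prog.WritesIdx, false_or, writesIdx_seqList, List.mem_map] at h
  obtain ⟨_, ⟨i, -, rfl⟩, h⟩ := h
  exact writesIdx_setBit _ _ h

theorem writesArr_setRow (D : ℕ) {a : Arr s} (h : (setRow D).WritesArr a) :
    a = aStack ∨ a = aCand := by
  simp only [setRow, Prog.WritesArr, Ref.name, writesArr_seqList, List.mem_map] at h
  rcases h with h | ⟨_, ⟨i, -, rfl⟩, h⟩
  · exact .inr h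
  · exact writesArr_setBit _ _ h

/-- The running time of `setRow`. -/
def rowTime (D : ℕ) : ℕ := (D + 1) * (elimTime D + 5) + 2

theorem total_setRow (hB : Bounds N D L B g) (hσ : Loaded N g σ)
    (hit : ItemsLe N D σ) {v : ℕ} (hv : σ.idx rV = v) (hvN : v < N) :
    Total B (rowTime D) (setRow D) σ fun τ =>
      τ.arr aCand v = pattern N g D (items σ) v ∧ ∀ k ≠ v, τ.arr aCand k = σ.arr aCand k := by
  refine Total.mono (Total.seq (Total.ratConst hB.ratSize_zero_le
    (Total.seqList_map (T := elimTime D + 5) (setBit D)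
    (fun τ => Loaded N g τ ∧ items τ = items σ ∧ τ.idx rV = v ∧
      (∀ k ≠ v, τ.arr aCand k = σ.arr aCand k) ∧
      (τ.arr aCand v = 1 ∧ (∃ i ≤ D, ItemPos N g D (items σ i) v) ∨ τ.arr aCand v = 0))
    (fun i τ => i ≤ D → ItemPos N g D (items σ i) v → τ.arr aCand v = 1) _ ?_ ?_)))
    (show 1 + ((List.range (D + 1)).length * (elimTime D + 5) + 1) ≤ rowTime D by
      simp [rowTime]; omega) ?_
  · refine ⟨hσ.of_eq rfl rfl (State.set_arr_of_ne _ _ _ (by simp [Ref.name])), rfl, hv, ?_, .inr ?_⟩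
    · intro k hk; simp [State.set_arr, Ref.name, Ref.pos, hv, hk]
    · simp [State.set_arr, Ref.name, Ref.pos, hv]
  · rintro i τ hi ⟨h1, h2, h3, h4, h5⟩
    have hi' : i ≤ D := by simpa [Nat.lt_succ_iff] using hi
    refine (total_setBit hB hi' h1 (hit.of_eq h2) h3 hvN).frame.imp ?_
    rintro ρ ⟨⟨g1, g2, g3⟩, f1, f2⟩
    rw [h2] at g1 g2
    have fi : ∀ x, x ≠ rTmp → ρ.idx x = τ.idx x := fun x hx =>
      f1 x fun h => hx (writesIdx_setBit _ _ h)
    have fa : ∀ a, a ≠ aStack → a ≠ aCand → ρ.arr a = τ.arr a := fun a ha ha' =>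
      f2 a fun h => (writesArr_setBit _ _ h).elim ha ha'
    refine ⟨⟨h1.of_eq (fi _ (by simp)) (fi _ (by simp)) (fa _ (by simp) (by simp)),
      (items_eq fun i q => fi _ (by simp)).trans h2, (fi _ (by simp)).trans h3,
      fun k hk => (g3 k hk).trans (h4 k hk), ?_⟩, fun _ h => g1 h, ?_⟩
    · by_cases hp : ItemPos N g D (items σ i) v
      · exact .inl ⟨g1 hp, i, hi', hp⟩
      · rw [g2 hp]; exact h5
    · intro j hj hjD hjp
      by_cases hp : ItemPos N g D (items σ i) v
      · exact g1 hp
      · rw [g2 hp]; exact hj hjD hjp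
  · rintro τ ⟨⟨-, -, -, h4, h5⟩, h6, -⟩
    refine ⟨?_, h4⟩
    unfold pattern
    split_ifs with hp
    · obtain ⟨i, hi, hp⟩ := hp
      exact h6 i (by simp; omega) hi hp
    · exact h5.resolve_left fun h => hp h.2

/-- Computes the candidate that belongs to the present signed columns, and continues it by the
entry `2`. -/
def setCand (D : ℕ) : Prog (Reg s) (Arr s) :=
  .seq (forUp rTmp rV rN (setRow D)) (.ratConst (.indirect aCand rN) 2)

/-- The vector `x` of length `N`, continued by the entry `2`. -/
def extend (N : ℕ) (x : ℕ → ℚ) (v : ℕ) : ℚ := if v < N then x v else 2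

theorem total_setCand (hB : Bounds N D L B g) (hσ : Loaded N g σ) (hit : ItemsLe N D σ) :
    Total B (N * (rowTime D + 3) + 3) (setCand D) σ fun τ =>
      ∀ v ≤ N, τ.arr aCand v = extend N (pattern N g D (items σ)) v := by
  have hlt := hB.lt
  refine Total.mono (Total.seq ((Total.forUp (T := rowTime D)
    (fun k τ => Loaded N g τ ∧ items τ = items σ ∧
      ∀ v < k, τ.arr aCand v = pattern N g D (items σ) v) (by simp) (by simp) (by simp)
    (fun h => by simpa using writesIdx_setRow _ h) (fun h => by simpa using writesIdx_setRow _ h)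
    hσ.idx_N (by omega) ⟨hσ, rfl, by simp⟩ ?_ ?_ ?_).imp ?_))
    (show N * (rowTime D + 3) + 2 + 1 ≤ _ by omega) fun _ h => h
  · rintro k τ v ⟨h1, h2, h3⟩
    exact ⟨h1.of_eq (by simp) (by simp) rfl, (items_eq (by simp)).trans h2, h3⟩
  · rintro k τ v ⟨h1, h2, h3⟩
    exact ⟨h1.of_eq (by simp) (by simp) rfl, (items_eq (by simp)).trans h2, h3⟩
  · rintro k τ hk hτ ⟨h1, h2, h3⟩
    refine (total_setRow hB h1 (hit.of_eq h2) hτ hk).frame.imp ?_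
    rintro ρ ⟨⟨g1, g2⟩, f1, f2⟩
    have fi : ∀ x, x ≠ rTmp → ρ.idx x = τ.idx x := fun x hx =>
      f1 x fun h => hx (writesIdx_setRow _ h)
    refine ⟨h1.of_eq (fi _ (by simp)) (fi _ (by simp)) (f2 _ fun h => ?_),
      (items_eq fun i q => fi _ (by simp)).trans h2, fun v hv => ?_⟩
    · simpa using writesArr_setRow _ h
    · rcases Nat.lt_succ_iff_lt_or_eq.1 hv with h | rfl
      · rw [g2 v h.ne, h3 v h]
      · rw [g1, h2]
  · rintro τ ⟨h1, h2, h3⟩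
    refine Total.ratConst hB.ratSize_two_le fun v hv => ?_
    simp only [State.set_arr, Ref.name, Ref.pos, h1.idx_N, true_and, extend]
    rcases hv.lt_or_eq with h | rfl
    · rw [if_neg h.ne, if_pos h, h3 v h]
    · simp

/-- Twice the objective value of `x` in terms of the table. -/
def score (N : ℕ) (g : ℕ → ℕ → ℚ) (x : ℕ → ℚ) : ℚ :=
  ∑ v ∈ Finset.range N, ∑ u ∈ Finset.range (N + 1), g v u * extend N x v * extend N x u

theorem score_congr {x y : ℕ → ℚ} (h : ∀ v < N, x v = y v) : score N g x = score N g y := by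
  have : extend N x = extend N y := by
    funext v; unfold extend; split_ifs with hv
    · exact h v hv
    · rfl
  rw [score, score, this]

/-- Adds the term of the objective that belongs to the row `rV` and the column `rU`. -/
def addTerm : Prog (Reg s) (Arr s) :=
  .seq (.idxArith .mul rTmp rV rW) (.seq (.idxArith .add rTmp rTmp rU)
    (.seq (.ratArith .mul (.direct aStack 0) (.indirect aTable rTmp) (.indirect aCand rV))
    (.seq (.ratArith .mul (.direct aStack 0) (.direct aStack 0) (.indirect aCand rU))
    (.ratArith .add (.direct aVal 0) (.direct aVal 0) (.direct aStack 0)))))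

theorem total_addTerm (hB : Bounds N D L B g) (hσ : Loaded N g σ) {x : ℕ → ℚ}
    (hx : ∀ v < N, x v = 0 ∨ x v = 1) (hX : ∀ v ≤ N, σ.arr aCand v = extend N x v) {v u t : ℕ}
    (hv : σ.idx rV = v) (hu : σ.idx rU = u) (hvN : v < N) (huN : u ≤ N)
    (ht : t < N * (N + 1)) (hacc : HeightLe (t * (L + 4)) (σ.arr aVal 0)) :
    Total B 5 addTerm σ fun τ =>
      τ.arr aVal 0 = σ.arr aVal 0 + g v u * extend N x v * extend N x u ∧
      HeightLe ((t + 1) * (L + 4)) (τ.arr aVal 0) ∧ τ.arr aVal 1 = σ.arr aVal 1 := by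
  have hX2 : ∀ v ≤ N, HeightLe 2 (extend N x v) := by
    intro v _
    unfold extend
    split_ifs with h
    · exact (heightLe_of_zero_or_one (hx v h)).mono (by norm_num)
    · exact heightLe_two
  have hterm : HeightLe (L + 4) (g v u * extend N x v * extend N x u) :=
    ((hB.height v u).mul (hX2 v hvN.le)).mul (hX2 u huN)
  have hsum := (hacc.add hterm).mono (b' := (t + 1) * (L + 4)) (by rw [Nat.succ_mul])
  have hmul : (t + 1) * (L + 4) ≤ N * (N + 1) * (L + 4) := Nat.mul_le_mul_right _ ht
  have h1 := address_lt hvN huN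
  have h2 := hB.idx_le
  have h3 : N * (N + 1) ≤ (N + 1) * (N + 1) := Nat.mul_le_mul_right _ (Nat.le_succ _)
  have h4 := hB.sum_le
  have h5 : (t + 1) * (L + 4) = t * (L + 4) + (L + 4) := Nat.succ_mul _ _
  have hW := hσ.idx_W
  have hT := hσ.table v hvN u huN
  have hXv := hX v hvN.le
  have hXu := hX u huN
  refine Total.mono (Total.seq (Total.idxArith ?_ (Total.seq (Total.idxArith ?_
    (Total.seq (Total.ratArith (by simp) ?_ (Total.seq (Total.ratArith (by simp) ?_
    (Total.ratArith (by simp) ?_ ?_)))))))))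
    (show 1 + (1 + (1 + (1 + 1))) ≤ 5 by omega) fun _ h => h
  · simp only [IdxOp.eval, hv, hW]; omega
  · simp [IdxOp.eval, hv, hW, hu]; omega
  · simp only [State.get, Ref.name, Ref.pos, State.setIdx_idx, State.setIdx_arr, IdxOp.eval,
      RatOp.eval, if_true, hv, hu, hW]
    simp [hT, hXv]
    exact ((hB.height v u).mul (hX2 v hvN.le)).ratSize_le.trans (by omega)
  · simp [State.get, Ref.name, Ref.pos, IdxOp.eval, RatOp.eval, State.set_arr, hv, hu, hW, hT, hXv,
      hXu]
    exact hterm.ratSize_le.trans (by omega)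
  · simp [State.get, Ref.name, Ref.pos, IdxOp.eval, RatOp.eval, State.set_arr, hv, hu, hW, hT, hXv,
      hXu]
    exact hsum.ratSize_le.trans (by omega)
  · simp [State.get, Ref.name, Ref.pos, IdxOp.eval, RatOp.eval, State.set_arr, hv, hu, hW, hT, hXv,
      hXu]
    exact hsum

/-- Computes twice the objective value of the candidate. -/
def setVal : Prog (Reg s) (Arr s) :=
  .seq (.ratConst (.direct aVal 0) 0) (forUp rTmp rV rN (forUp rTmp rU rW addTerm))

theorem total_setVal (hB : Bounds N D L B g) (hσ : Loaded N g σ) {x : ℕ → ℚ}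
    (hx : ∀ v < N, x v = 0 ∨ x v = 1) (hX : ∀ v ≤ N, σ.arr aCand v = extend N x v) :
    Total B (N * ((N + 1) * 8 + 5) + 3) setVal σ fun τ =>
      τ.arr aVal 0 = score N g x ∧ HeightLe (N * (N + 1) * (L + 4)) (τ.arr aVal 0) ∧
      τ.arr aVal 1 = σ.arr aVal 1 := by
  have hlt := hB.lt
  -- The data that both loops leave alone.
  let J : State (Reg s) (Arr s) → Prop := fun τ =>
    Loaded N g τ ∧ (∀ v ≤ N, τ.arr aCand v = extend N x v) ∧ τ.arr aVal 1 = σ.arr aVal 1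
  let row : ℕ → ℕ → ℚ := fun v k => ∑ u ∈ Finset.range k, g v u * extend N x v * extend N x u
  have hJ : ∀ τ i v, i ∈ ({rV, rU, rTmp} : Set (Reg s)) → J τ → J (τ.setIdx i v) := by
    rintro τ i v hi ⟨h1, h2, h3⟩
    refine ⟨h1.of_eq ?_ ?_ rfl, h2, h3⟩ <;> rcases hi with rfl | rfl | rfl <;> simp
  refine Total.mono (Total.seq (Total.ratConst hB.ratSize_zero_le (Total.forUp
    (T := (N + 1) * 8 + 2) (N := N)
    (fun k τ => J τ ∧ τ.arr aVal 0 = ∑ v ∈ Finset.range k, row v (N + 1) ∧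
      HeightLe (k * (N + 1) * (L + 4)) (τ.arr aVal 0)) (by simp) (by simp) (by simp)
    (by simp [addTerm, Prog.WritesIdx]) (by simp [addTerm, Prog.WritesIdx]) hσ.idx_N (by omega) ?_
    (fun k τ v h => ⟨hJ τ rV v (by simp) h.1, h.2⟩)
    (fun k τ v h => ⟨hJ τ rTmp v (by simp) h.1, h.2⟩) ?_)))
    (le_of_eq (by ring)) ?_
  · refine ⟨⟨hσ.of_eq rfl rfl (State.set_arr_of_ne _ _ _ (by simp [Ref.name])), ?_, ?_⟩, ?_, ?_⟩
    · rw [State.set_arr_of_ne _ _ _ (by simp [Ref.name])]; exact hX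
    · simp [State.set_arr, Ref.name, Ref.pos]
    · simp [State.set_arr, Ref.name, Ref.pos]
    · simpa [State.set_arr, Ref.name, Ref.pos] using heightLe_zero
  · rintro v τ hvN hv ⟨h1, h2, h3⟩
    refine Total.mono (Total.forUp (T := 5) (N := N + 1)
      (fun k ρ => J ρ ∧ ρ.idx rV = v ∧
        ρ.arr aVal 0 = ∑ v ∈ Finset.range v, row v (N + 1) + row v k ∧
        HeightLe ((v * (N + 1) + k) * (L + 4)) (ρ.arr aVal 0)) (by simp) (by simp) (by simp)
      (by simp [addTerm, Prog.WritesIdx]) (by simp [addTerm, Prog.WritesIdx]) h1.1.idx_W hlt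
      ⟨h1, hv, by simp [row, h2], by simpa using h3⟩
      (fun k τ w h => ⟨hJ τ rU w (by simp) h.1, by simpa using h.2⟩)
      (fun k τ w h => ⟨hJ τ rTmp w (by simp) h.1, by simpa using h.2⟩) ?_) (by omega) ?_
    · rintro u ρ huN hu ⟨⟨g1, g2, g3⟩, g4, g5, g6⟩
      have huN' : u ≤ N := by omega
      refine (total_addTerm hB g1 hx g2 g4 hu hvN huN' (address_lt hvN huN') g6).frame.imp ?_
      rintro θ ⟨⟨t1, t2, t3⟩, f1, f2⟩
      have fi : ∀ x, x ≠ rTmp → θ.idx x = ρ.idx x := fun x hx =>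
        f1 x (by simpa [addTerm, Prog.WritesIdx] using hx)
      have fa : ∀ a, a ≠ aStack → a ≠ aVal → θ.arr a = ρ.arr a := fun a ha ha' =>
        f2 a (by simp [addTerm, Prog.WritesArr, Ref.name, ha, ha'])
      refine ⟨⟨g1.of_eq (fi _ (by simp)) (fi _ (by simp)) (fa _ (by simp) (by simp)), ?_,
        t3.trans g3⟩, (fi _ (by simp)).trans g4, ?_, t2⟩
      · rw [fa _ (by simp) (by simp)]; exact g2
      · rw [t1, g5, add_assoc]; simp only [row, Finset.sum_range_succ _ u]
    · rintro ρ ⟨g1, -, g3, g4⟩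
      exact ⟨g1, by rw [g3, Finset.sum_range_succ], by rwa [Nat.succ_mul]⟩
  · rintro τ ⟨h1, h2, h3⟩
    exact ⟨h2, h3, h1.2.2⟩

/-- Replaces the best solution by the candidate if that is better. -/
def update : Prog (Reg s) (Arr s) :=
  .ite (.ratLt (.direct aVal 1) (.direct aVal 0))
    (.seq (.ratCopy (.direct aVal 1) (.direct aVal 0))
      (forUp rTmp rV rN (.ratCopy (.indirect aBest rV) (.indirect aCand rV)))) .skip

/-- A state of the search: the best solution is feasible, and its value is known. -/
structure Searching (N : ℕ) (g : ℕ → ℕ → ℚ) (σ : State (Reg s) (Arr s)) : Prop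
    extends Loaded N g σ where
  bit : ∀ v < N, σ.arr aBest v = 0 ∨ σ.arr aBest v = 1
  val : σ.arr aVal 1 = score N g (σ.arr aBest)

theorem total_update (hB : Bounds N D L B g) (hσ : Searching N g σ) {x : ℕ → ℚ}
    (hx : ∀ v < N, x v = 0 ∨ x v = 1) (hX : ∀ v ≤ N, σ.arr aCand v = extend N x v)
    (hval : σ.arr aVal 0 = score N g x)
    (hheight : HeightLe (N * (N + 1) * (L + 4)) (σ.arr aVal 0)) :
    Total B (N * 4 + 4) update σ fun τ =>
      Searching N g τ ∧ σ.arr aVal 1 ≤ τ.arr aVal 1 ∧ score N g x ≤ τ.arr aVal 1 := by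
  have hlt := hB.lt
  have hXx : ∀ v < N, σ.arr aCand v = x v := fun v hv => by rw [hX v hv.le, extend, if_pos hv]
  refine Total.mono (Total.ite (T := N * 4 + 3) (fun h => ?_) fun h =>
    (Total.skip ⟨hσ, le_rfl, ?_⟩).mono (by omega) fun _ h => h) (by omega) fun _ h => h
  · simp only [Test.Holds, State.get, Ref.name, Ref.pos, hval] at h
    refine Total.mono (Total.seq (Total.ratCopy (hheight.ratSize_le.trans hB.sum_le)
      (Total.forUp (T := 1) (N := N)
      (fun k τ => Loaded N g τ ∧ τ.arr aCand = σ.arr aCand ∧ τ.arr aVal 1 = score N g x ∧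
        ∀ v < k, τ.arr aBest v = x v) (by simp) (by simp) (by simp)
      (by simp [Prog.WritesIdx]) (by simp [Prog.WritesIdx]) hσ.idx_N (by omega) ?_ ?_ ?_ ?_)))
      (show 1 + (N * (1 + 3) + 2) ≤ _ by omega) ?_
    · refine ⟨hσ.toLoaded.of_eq rfl rfl (State.set_arr_of_ne _ _ _ (by simp [Ref.name])),
        State.set_arr_of_ne _ _ _ (by simp [Ref.name]), ?_, by simp⟩
      simp [State.set_arr, Ref.name, Ref.pos, State.get, hval]
    · rintro k τ v ⟨h1, h2⟩
      exact ⟨h1.of_eq (by simp) (by simp) rfl, h2⟩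
    · rintro k τ v ⟨h1, h2⟩
      exact ⟨h1.of_eq (by simp) (by simp) rfl, h2⟩
    · rintro k τ hk hτ ⟨h1, h2, h3, h4⟩
      have hget : τ.get (.indirect aCand rV) = x k := by
        simp only [State.get, Ref.name, Ref.pos, hτ, h2, hXx k hk]
      refine Total.ratCopy ?_ ⟨h1.of_eq rfl rfl (State.set_arr_of_ne _ _ _ (by simp [Ref.name])),
        (State.set_arr_of_ne _ _ _ (by simp [Ref.name])).trans h2, ?_, fun v hv => ?_⟩
      · rw [hget]
        rcases hx k hk with h | h <;> rw [h]
        · exact hB.ratSize_zero_le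
        · exact hB.ratSize_one_le
      · rw [State.set_arr_of_ne _ _ _ (by simp [Ref.name])]; exact h3
      · simp only [State.set_arr, Ref.name, Ref.pos, hτ, true_and, hget]
        split_ifs with h
        · rw [h]
        · exact h4 v (by omega)
    · rintro τ ⟨h1, h2, h3, h4⟩
      refine ⟨⟨h1, fun v hv => by rw [h4 v hv]; exact hx v hv, ?_⟩, ?_, h3.ge⟩
      · rw [h3]; exact score_congr fun v hv => (h4 v hv).symm
      · rw [h3]; exact h.le
  · simpa only [Test.Holds, State.get, Ref.name, Ref.pos, hval, not_lt] using h

/-- Tries the present signed columns. -/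
def tryItems (D : ℕ) : Prog (Reg s) (Arr s) := .seq (setCand D) (.seq setVal update)

theorem writesIdx_tryItems (D : ℕ) {x : Reg s} (h : (tryItems D).WritesIdx x) :
    x = rTmp ∨ x = rV ∨ x = rU := by
  simp only [tryItems, setCand, setVal, update, addTerm, Prog.WritesIdx, writesIdx_forUp] at h
  have := @writesIdx_setRow s D x
  tauto

/-- The running time of `tryItems`. -/
def tryTime (N D : ℕ) : ℕ :=
  N * (rowTime D + 3) + 3 + (N * ((N + 1) * 8 + 5) + 3 + (N * 4 + 4))

theorem total_tryItems (hB : Bounds N D L B g) (hσ : Searching N g σ) (hit : ItemsLe N D σ) :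
    Total B (tryTime N D) (tryItems D) σ fun τ => Searching N g τ ∧
      σ.arr aVal 1 ≤ τ.arr aVal 1 ∧ score N g (pattern N g D (items σ)) ≤ τ.arr aVal 1 := by
  have hx : ∀ v < N, pattern N g D (items σ) v = 0 ∨ pattern N g D (items σ) v = 1 :=
    fun v _ => pattern_zero_or_one _ _ _ _ _
  refine Total.seq ((total_setCand hB hσ.toLoaded hit).frame.imp ?_)
  rintro ρ ⟨h1, f1, f2⟩
  have fi : ∀ x, x ≠ rTmp → x ≠ rV → ρ.idx x = σ.idx x := by
    intro x hx hx'
    refine f1 x fun h => ?_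
    simp only [setCand, Prog.WritesIdx, writesIdx_forUp] at h
    have := @writesIdx_setRow s D x
    tauto
  have fa : ∀ a, a ≠ aStack → a ≠ aCand → ρ.arr a = σ.arr a := by
    intro a ha ha'
    refine f2 a fun h => ?_
    simp only [setCand, Prog.WritesArr, writesArr_forUp, Ref.name] at h
    have := @writesArr_setRow s D a
    tauto
  have hρ : Loaded N g ρ := hσ.toLoaded.of_eq (fi _ (by simp) (by simp)) (fi _ (by simp) (by simp))
    (fa _ (by simp) (by simp))
  refine Total.seq ((total_setVal hB hρ hx h1).frame.imp ?_)
  rintro θ ⟨⟨h2, h3, h4⟩, f3, f4⟩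
  have gi : ∀ x, x ≠ rTmp → x ≠ rV → x ≠ rU → θ.idx x = ρ.idx x := by
    intro x hx hx' hx''
    exact f3 x (by simp [setVal, addTerm, Prog.WritesIdx, hx, hx', hx''])
  have ga : ∀ a, a ≠ aStack → a ≠ aVal → θ.arr a = ρ.arr a := by
    intro a ha ha'
    exact f4 a (by simp [setVal, addTerm, Prog.WritesArr, Ref.name, ha, ha'])
  have hv : θ.arr aVal 1 = σ.arr aVal 1 := by rw [h4, fa _ (by simp) (by simp)]
  have hb : θ.arr aBest = σ.arr aBest := by
    rw [ga _ (by simp) (by simp), fa _ (by simp) (by simp)]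
  have hθ : Searching N g θ :=
    { toLoaded := hρ.of_eq (gi _ (by simp) (by simp) (by simp)) (gi _ (by simp) (by simp) (by simp))
        (ga _ (by simp) (by simp))
      bit := by rw [hb]; exact hσ.bit
      val := by rw [hb, hv]; exact hσ.val }
  rw [← hv]
  refine total_update hB hθ hx ?_ h2 h3
  rw [ga _ (by simp) (by simp)]; exact h1

/-- The registers that hold the signed columns. -/
def itemRegs (D : ℕ) : List (Reg s) :=
  (List.range (D + 1) ×ˢ List.range (2 * D + 2)).map fun p => rItem p.1 p.2

theorem mem_itemRegs {x : Reg s} :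
    x ∈ itemRegs D ↔ ∃ i ≤ D, ∃ q < 2 * D + 2, x = rItem i q := by
  simp only [itemRegs, List.mem_map, List.mem_product, List.mem_range, Prod.exists]
  constructor
  · rintro ⟨i, q, ⟨h1, h2⟩, rfl⟩
    exact ⟨i, by omega, q, h2, rfl⟩
  · rintro ⟨i, h1, q, h2, rfl⟩
    exact ⟨i, q, ⟨by omega, h2⟩, rfl⟩

theorem nodup_itemRegs : (itemRegs D : List (Reg s)).Nodup := by
  refine List.Nodup.map ?_ (List.nodup_range.product List.nodup_range)
  rintro ⟨i, q⟩ ⟨i', q'⟩ h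
  simpa [Nat.pair_eq_pair] using h

/-- Tries all signed columns. -/
def search (D : ℕ) : Prog (Reg s) (Arr s) := enum rTmp rW (tryItems D) (itemRegs D)

theorem total_search (hB : Bounds N D L B g) (hσ : Searching N g σ) :
    Total B (enumTime (N + 1) (tryTime N D) (itemRegs D : List (Reg s)).length) (search D) σ
      fun τ => Searching N g τ ∧ σ.arr aVal 1 ≤ τ.arr aVal 1 ∧
        ∀ its : ℕ → ℕ → ℕ, (∀ i q, its i q ≤ N) →
          score N g (pattern N g D its) ≤ τ.arr aVal 1 := by
  have hlt := hB.lt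
  have hmem : ∀ x : Reg s, x ∈ itemRegs D → x ≠ rTmp ∧ x ≠ rV ∧ x ≠ rU ∧ x ≠ rN ∧ x ≠ rW := by
    intro x hx
    obtain ⟨i, -, q, -, rfl⟩ := mem_itemRegs.1 hx
    simp
  have hset : ∀ (τ : State (Reg s) (Arr s)) x v, x ∈ {x | x ∈ itemRegs D} ∨ x = rTmp →
      Searching N g τ → Searching N g (τ.setIdx x v) := by
    intro τ x v hx h
    have hx' : x ≠ rN ∧ x ≠ rW := by
      rcases hx with hx | rfl
      · exact ⟨(hmem x hx).2.2.2.1, (hmem x hx).2.2.2.2⟩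
      · simp
    exact { toLoaded := h.toLoaded.of_eq (by simp [hx'.1.symm]) (by simp [hx'.2.symm]) rfl
            bit := h.bit, val := h.val }
  refine (Total.enum (N := N + 1) {x | x ∈ itemRegs D}
    (fun a => score N g (pattern N g D fun i q => a (rItem i q))) (fun τ => τ.arr aVal 1)
    (Searching N g) (fun h => (hmem _ h).1 rfl) (fun h => (hmem _ h).2.2.2.2 rfl) (by simp) ?_ ?_
    hlt (fun τ h => h.idx_W) ?_ hset (fun _ _ _ => rfl) ?_ _ nodup_itemRegs
    (fun _ h => h) hσ (fun _ h h' => absurd h h')).imp ?_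
  · intro x hx h
    have := hmem x hx
    rcases writesIdx_tryItems D h with h | h | h <;> tauto
  · intro h
    simpa using writesIdx_tryItems D h
  · intro a b hab
    have := pattern_congr N g (D := D) (its := fun i q => a (rItem i q))
      (its' := fun i q => b (rItem i q))
      fun i hi q hq => hab _ (mem_itemRegs.2 ⟨i, hi, q, hq, rfl⟩)
    exact congrArg _ this
  · intro τ hτ hle
    exact total_tryItems hB hτ fun i hi q hq =>
      Nat.le_of_lt_succ (hle _ (mem_itemRegs.2 ⟨i, hi, q, hq, rfl⟩))
  · rintro τ ⟨h1, h2, h3⟩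
    refine ⟨h1, h2, fun its hits => ?_⟩
    -- Register number `2 * pair i q + 11` is given the value `its i q`.
    let a : Reg s → ℕ
      | .n _ => 0
      | .work k => its ((k - 11) / 2).unpair.1 ((k - 11) / 2).unpair.2
    have ha : (fun i q => a (rItem i q)) = its := by
      funext i q; simp [a]
    have := h3 a (fun x hx => ?_) fun x hx hx' => absurd hx hx'
    · rwa [ha] at this
    · obtain ⟨i, -, q, -, rfl⟩ := mem_itemRegs.1 hx
      exact Nat.lt_succ_of_le (hits _ _)

end

end QuadInstance

/-! ### Input and output -/

namespace QuadInstance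

open RatRAM PivotElim

variable {s : ℕ}

/-- Holds an address in an input matrix. -/
abbrev rAddr : Reg s := .work 5
/-- Holds the number of variables before the block `m`. -/
abbrev rOff (m : ℕ) : Reg s := .work (2 * m + 10)

/-- Computes the offsets of the blocks up to `m`; the offset of the block `0` is initially there. -/
def loadOffsets : ℕ → Prog (Reg s) (Arr s)
  | 0 => .skip
  | m + 1 => .seq (loadOffsets m)
      (if h : m < s then .idxArith .add (rOff (m + 1)) (rOff m) (.n ⟨m, h⟩) else .skip)

theorem offset_succ (P : QuadInstance s) {m : ℕ} (h : m < s) :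
    P.offset (m + 1) = P.offset m + P.n ⟨m, h⟩ := by
  rw [offset, Finset.sum_range_succ, dif_pos h, offset]

theorem offset_mono (P : QuadInstance s) {m m' : ℕ} (h : m ≤ m') : P.offset m ≤ P.offset m' :=
  Finset.sum_le_sum_of_subset (Finset.range_subset_range.2 h)

theorem n_le_size (P : QuadInstance s) (j : Fin s) : P.n j ≤ P.size :=
  Finset.single_le_sum (f := P.n) (fun _ _ => Nat.zero_le _) (Finset.mem_univ j)

theorem total_loadOffsets (P : QuadInstance s) {B : ℕ} (hB : P.size ≤ B) (m : ℕ) (hm : m ≤ s) :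
    Total B (2 * m + 1) (loadOffsets m) P.input fun τ =>
      (∀ i ≤ m, τ.idx (rOff i) = P.offset i) ∧ (∀ j, τ.idx (.n j) = P.n j) ∧
      τ.arr = P.input.arr := by
  induction m with
  | zero =>
    refine Total.skip ⟨fun i hi => ?_, fun j => rfl, rfl⟩
    rw [Nat.le_zero.1 hi]; rfl
  | succ m ih =>
    refine Total.mono (Total.seq ((ih (by omega)).imp ?_) : Total B (2 * m + 1 + 1) _ _ _)
      (by omega) fun _ h => h
    rintro τ ⟨h1, h2, h3⟩
    rw [dif_pos (show m < s from hm)]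
    have e : τ.idx (rOff m) + τ.idx (.n ⟨m, hm⟩) = P.offset (m + 1) := by
      rw [h1 m le_rfl, h2, offset_succ]
    refine Total.idxArith ?_ ⟨fun i hi => ?_, fun j => by simpa using h2 j, h3⟩
    · simp only [IdxOp.eval, e]
      refine le_trans ?_ hB
      rw [← offset_self]
      exact P.offset_mono hm
    · simp only [IdxOp.eval, e, State.setIdx_idx]
      split_ifs with h
      · have : i = m + 1 := by simpa using h
        rw [this]
      · refine h1 i (Nat.le_of_lt_succ (lt_of_le_of_ne hi fun h' => h (by rw [h'])))

/-- Copies `src` to the table, to the row `o₁ + k₁` and the column `o₂ + k₂`. -/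
def putEntry (o₁ k₁ o₂ k₂ : Reg s) (src : Ref (Reg s) (Arr s)) : Prog (Reg s) (Arr s) :=
  .seq (.idxArith .add rTmp o₁ k₁) (.seq (.idxArith .mul rTmp rTmp rW)
    (.seq (.idxArith .add rTmp rTmp o₂) (.seq (.idxArith .add rTmp rTmp k₂)
    (.ratCopy (.indirect aTable rTmp) src))))

/-- The dimensions are known, and only the table differs from the input. -/
structure Loading (P : QuadInstance s) (σ : State (Reg s) (Arr s)) : Prop where
  off : ∀ i ≤ s, σ.idx (rOff i) = P.offset i
  n : ∀ j, σ.idx (.n j) = P.n j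
  idx_N : σ.idx rN = P.size
  idx_W : σ.idx rW = P.size + 1
  arr : ∀ a, a ≠ aTable → σ.arr a = P.input.arr a

theorem Loading.of_eq {P : QuadInstance s} {σ τ : State (Reg s) (Arr s)} (h : Loading P σ)
    (h1 : ∀ x, x ≠ rTmp → x ≠ rV → x ≠ rU → x ≠ rAddr → τ.idx x = σ.idx x)
    (h2 : ∀ a, a ≠ aTable → τ.arr a = σ.arr a) : Loading P τ where
  off i hi := (h1 _ (by simp) (by simp) (by simp) (by simp)).trans (h.off i hi)
  n j := (h1 _ (by simp) (by simp) (by simp) (by simp)).trans (h.n j)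
  idx_N := (h1 _ (by simp) (by simp) (by simp) (by simp)).trans h.idx_N
  idx_W := (h1 _ (by simp) (by simp) (by simp) (by simp)).trans h.idx_W
  arr a ha := (h2 a ha).trans (h.arr a ha)

theorem Loading.setIdx {P : QuadInstance s} {σ : State (Reg s) (Arr s)} (h : Loading P σ)
    {x : Reg s} (hx : x = rTmp ∨ x = rV ∨ x = rU ∨ x = rAddr) (v : ℕ) :
    Loading P (σ.setIdx x v) := by
  refine h.of_eq (fun y h1 h2 h3 h4 => ?_) fun _ _ => rfl
  rcases hx with rfl | rfl | rfl | rfl <;> simp_all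

/-- The entry of the table in the row `v` and the column `u` is there. -/
def Done (P : QuadInstance s) (v u : ℕ) (σ : State (Reg s) (Arr s)) : Prop :=
  σ.arr aTable (v * (P.size + 1) + u) = P.table v u

/-- No entry of the table that is in `σ` gets lost in `τ`. -/
def Keeps (P : QuadInstance s) (σ τ : State (Reg s) (Arr s)) : Prop :=
  ∀ v u, u ≤ P.size → Done P v u σ → Done P v u τ

theorem address_inj {N v u v' u' : ℕ} (hu : u ≤ N) (hu' : u' ≤ N)
    (h : v * (N + 1) + u = v' * (N + 1) + u') : v = v' ∧ u = u' := by
  have h1 := congrArg (· % (N + 1)) h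
  simp only [Nat.mul_add_mod_self_right, Nat.mod_eq_of_lt (Nat.lt_succ_of_le hu),
    Nat.mod_eq_of_lt (Nat.lt_succ_of_le hu')] at h1
  subst h1
  exact ⟨Nat.eq_of_mul_eq_mul_right (Nat.succ_pos N) (Nat.add_right_cancel h), rfl⟩

section

variable {P : QuadInstance s} {D L B : ℕ} {σ : State (Reg s) (Arr s)}

theorem total_putEntry (hB : Bounds P.size D L B P.table) (hσ : Loading P σ)
    {o₁ k₁ o₂ k₂ : Reg s} {src : Ref (Reg s) (Arr s)} {v u : ℕ} (ho₂ : o₂ ≠ rTmp) (hk₂ : k₂ ≠ rTmp)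
    (hv : σ.idx o₁ + σ.idx k₁ = v) (hu : σ.idx o₂ + σ.idx k₂ = u) (hvN : v < P.size)
    (huN : u ≤ P.size) (hsrc : ∀ w, (σ.setIdx rTmp w).get src = P.table v u) :
    Total B 5 (putEntry o₁ k₁ o₂ k₂ src) σ fun τ => Loading P τ ∧ Keeps P σ τ ∧ Done P v u τ ∧
      ∀ x, x ≠ rTmp → τ.idx x = σ.idx x := by
  have hlt := hB.lt
  have h1 := address_lt hvN huN
  have h2 := hB.idx_le
  have h3 : P.size * (P.size + 1) ≤ (P.size + 1) * (P.size + 1) :=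
    Nat.mul_le_mul_right _ (Nat.le_succ _)
  have h4 : ratSize (P.table v u) ≤ B := by
    refine ((hB.height _ _).ratSize_le).trans (le_trans ?_ hB.elim_le)
    have := Nat.le_mul_of_pos_left L (Nat.pow_pos (n := D) (show 0 < 4 by norm_num))
    omega
  have hss : ∀ (τ : State (Reg s) (Arr s)) a b,
      (τ.setIdx rTmp a).setIdx rTmp b = τ.setIdx rTmp b := by
    intro τ a b; simp [State.setIdx]
  have hW := hσ.idx_W
  refine Total.mono (Total.seq (Total.idxArith ?_ (Total.seq (Total.idxArith ?_
    (Total.seq (Total.idxArith ?_ (Total.seq (Total.idxArith ?_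
    (Total.ratCopy ?_ ?_)))))))))
    (show 1 + (1 + (1 + (1 + 1))) ≤ 5 by omega) fun _ h => h
  · simp only [IdxOp.eval, hv]; omega
  · simp [IdxOp.eval, hv, hW]; omega
  · simp [IdxOp.eval, hv, hW, ho₂]; omega
  · simp [IdxOp.eval, hv, hW, ho₂, hk₂]; omega
  · simp only [hss, hsrc]; exact h4
  · simp only [hss, hsrc]
    simp only [IdxOp.eval, State.setIdx_idx, if_true, hv, hW, if_neg ho₂, if_neg hk₂, add_assoc, hu,
      if_neg (show (rW : Reg s) ≠ rTmp by simp)]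
    refine ⟨(hσ.setIdx (.inl rfl) _).of_eq (fun _ _ _ _ _ => rfl) fun a ha =>
      State.set_arr_of_ne _ _ _ ha, fun v' u' hu' hd => ?_, ?_, fun x hx => by simp [hx]⟩
    · simp only [Done, State.set_arr, Ref.name, Ref.pos, true_and, State.setIdx_idx, if_true]
      split_ifs with h
      · obtain ⟨rfl, rfl⟩ := address_inj hu' huN h
        rfl
      · exact hd
    · simp [Done, State.set_arr, Ref.name, Ref.pos]

/-- Copies the entries of `Q^{i,j}` to the table, together with those of the transpose. -/
def loadBlock (i j : Fin s) : Prog (Reg s) (Arr s) :=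
  forUp rTmp rV (.n i) (forUp rTmp rU (.n j)
    (.seq (.idxArith .mul rAddr (.n j) rV) (.seq (.idxArith .add rAddr rAddr rU)
    (.seq (putEntry (rOff i) rV (rOff j) rU (.indirect (.Q i j) rAddr))
      (putEntry (rOff j) rU (rOff i) rV (.indirect (.Q i j) rAddr))))))

theorem input_Q (P : QuadInstance s) {i j : Fin s} (h : i < j) (k : Fin (P.n i))
    (l : Fin (P.n j)) : P.input.arr (.Q i j) (P.n j * k + l) = P.Q i j h k l := by
  have e : (finProdFinEquiv (k, l) : ℕ) = P.n j * k + l := by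
    rw [finProdFinEquiv_apply_val, add_comm]
  have hlt : P.n j * k + l < P.n i * P.n j := e ▸ (finProdFinEquiv (k, l)).2
  have e' : finProdFinEquiv.symm ⟨P.n j * k + l, hlt⟩ = (k, l) := by
    rw [Equiv.symm_apply_eq]; exact Fin.ext e.symm
  simp only [input]
  rw [dif_pos ⟨h, hlt⟩, e']

theorem table_num (P : QuadInstance s) (p q : Σ j, Fin (P.n j)) :
    P.table (P.num p) (P.num q) = P.sym p q := by
  simp [table]

theorem table_size (P : QuadInstance s) (p : Σ j, Fin (P.n j)) :
    P.table (P.num p) P.size = P.lin p := by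
  simp [table]

theorem total_loadBlock (hB : Bounds P.size D L B P.table) {i j : Fin s} (hij : i < j)
    (hσ : Loading P σ) :
    Total B (P.size * (P.size * 15 + 5) + 2) (loadBlock i j) σ fun τ =>
      Loading P τ ∧ Keeps P σ τ ∧ ∀ k l, Done P (P.num ⟨i, k⟩) (P.num ⟨j, l⟩) τ ∧
        Done P (P.num ⟨j, l⟩) (P.num ⟨i, k⟩) τ := by
  have hlt := hB.lt
  have hi := P.n_le_size i
  have hj := P.n_le_size j
  have keep : ∀ {τ ρ : State (Reg s) (Arr s)}, Keeps P τ ρ → ∀ {k l},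
      (Done P (P.num ⟨i, k⟩) (P.num ⟨j, l⟩) τ ∧ Done P (P.num ⟨j, l⟩) (P.num ⟨i, k⟩) τ) →
      Done P (P.num ⟨i, k⟩) (P.num ⟨j, l⟩) ρ ∧ Done P (P.num ⟨j, l⟩) (P.num ⟨i, k⟩) ρ :=
    fun h _ _ hd => ⟨h _ _ (Fin.is_lt _).le hd.1, h _ _ (Fin.is_lt _).le hd.2⟩
  refine Total.mono (Total.forUp (T := P.size * 15 + 2) (N := P.n i)
    (fun k τ => Loading P τ ∧ Keeps P σ τ ∧ ∀ k' : Fin (P.n i), (k' : ℕ) < k → ∀ l,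
      Done P (P.num ⟨i, k'⟩) (P.num ⟨j, l⟩) τ ∧ Done P (P.num ⟨j, l⟩) (P.num ⟨i, k'⟩) τ)
    (by simp) (by simp) (by simp) (by simp [putEntry, Prog.WritesIdx])
    (by simp [putEntry, Prog.WritesIdx]) (hσ.n i) (by omega) ⟨hσ, fun _ _ _ h => h, by simp⟩
    (fun k τ v h => ⟨h.1.setIdx (by simp) v, h.2⟩)
    (fun k τ v h => ⟨h.1.setIdx (by simp) v, h.2⟩) ?_)
    (show P.n i * (P.size * 15 + 2 + 3) + 2 ≤ _ by gcongr) ?_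
  · rintro k τ hk hτ ⟨h1, h2, h3⟩
    refine Total.mono (Total.forUp (T := 12) (N := P.n j)
      (fun l ρ => Loading P ρ ∧ Keeps P τ ρ ∧ ρ.idx rV = k ∧ ∀ l' : Fin (P.n j), (l' : ℕ) < l →
        Done P (P.num ⟨i, ⟨k, hk⟩⟩) (P.num ⟨j, l'⟩) ρ ∧
        Done P (P.num ⟨j, l'⟩) (P.num ⟨i, ⟨k, hk⟩⟩) ρ)
      (by simp) (by simp) (by simp) (by simp [putEntry, Prog.WritesIdx])
      (by simp [putEntry, Prog.WritesIdx]) (h1.n j) (by omega)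
      ⟨h1, fun _ _ _ h => h, hτ, by simp⟩
      (fun k τ v h => ⟨h.1.setIdx (by simp) v, h.2.1, by simpa using h.2.2.1, h.2.2.2⟩)
      (fun k τ v h => ⟨h.1.setIdx (by simp) v, h.2.1, by simpa using h.2.2.1, h.2.2.2⟩) ?_)
      (show P.n j * (12 + 3) + 2 ≤ _ by gcongr) ?_
    · rintro l ρ hl hρ ⟨g1, g2, g3, g4⟩
      have hk' := P.num_val i ⟨k, hk⟩
      have hl' := P.num_val j ⟨l, hl⟩
      have hkN := Fin.is_lt (P.num ⟨i, ⟨k, hk⟩⟩)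
      have hlN := Fin.is_lt (P.num ⟨j, ⟨l, hl⟩⟩)
      have haddr : P.n j * k + l ≤ (P.size + 1) * (P.size + 1) := by nlinarith
      have hle := hB.idx_le
      refine Total.mono (Total.seq (Total.idxArith ?_ (Total.seq (Total.idxArith ?_
        (Total.seq ((total_putEntry (v := P.num ⟨i, ⟨k, hk⟩⟩) (u := P.num ⟨j, ⟨l, hl⟩⟩) hB
          ((g1.setIdx (by simp) _).setIdx (by simp) _) (by simp) (by simp) ?_ ?_ hkN hlN.le ?_).imp
          ?_))))))
        (show 1 + (1 + (5 + 5)) ≤ 12 by omega) fun _ h => h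
      · simp only [IdxOp.eval, g1.n, g3]; omega
      · simp [IdxOp.eval, g1.n, g3, hρ]; omega
      · simp [g1.off i i.2.le, g3, hk']
      · simp [g1.off j j.2.le, hρ, hl']
      · intro w
        simp only [State.get, Ref.name, Ref.pos, State.setIdx_arr,
          g1.arr _ (by simp : Arr.Q i j ≠ _)]
        simp only [State.setIdx_idx, IdxOp.eval, g1.n, g3]
        simp only [if_false, if_true, hρ,
          show (rU : Reg s) ≠ rAddr by simp, show (rAddr : Reg s) ≠ rTmp by simp]
        rw [table_num, P.sym_of_lt hij]
        exact P.input_Q hij ⟨k, hk⟩ ⟨l, hl⟩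
      · rintro θ ⟨t1, t2, t3, t4⟩
        refine (total_putEntry (v := P.num ⟨j, ⟨l, hl⟩⟩) (u := P.num ⟨i, ⟨k, hk⟩⟩) hB
          t1 (by simp) (by simp) ?_ ?_ hlN hkN.le ?_).imp ?_
        · rw [t1.off j j.2.le, t4 _ (by simp), hl']; simp [hρ]
        · rw [t1.off i i.2.le, t4 _ (by simp), hk']; simp [g3]
        · intro w
          simp only [State.get, Ref.name, Ref.pos, State.setIdx_arr,
            t1.arr _ (by simp : Arr.Q i j ≠ _)]
          rw [State.setIdx_idx, if_neg (by simp), t4 _ (by simp)]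
          simp only [State.setIdx_idx, IdxOp.eval, g1.n, g3]
          simp only [if_false, if_true, hρ,
            show (rU : Reg s) ≠ rAddr by simp]
          rw [table_num, P.sym_of_gt hij]
          exact P.input_Q hij ⟨k, hk⟩ ⟨l, hl⟩
        · rintro ζ ⟨z1, z2, z3, z4⟩
          have hkeep : Keeps P ρ ζ := fun v u hu h => z2 v u hu (t2 v u hu h)
          refine ⟨z1, fun v u hu h => hkeep v u hu (g2 v u hu h), ?_, fun l' hl'' => ?_⟩
          · rw [z4 _ (by simp), t4 _ (by simp)]; simpa using g3
          · rcases Nat.lt_succ_iff_lt_or_eq.1 hl'' with h | h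
            · exact keep hkeep (g4 l' h)
            · have : l' = ⟨l, hl⟩ := Fin.ext h
              rw [this]
              exact ⟨z2 _ _ hlN.le t3, z3⟩
    · rintro ρ ⟨g1, g2, -, g4⟩
      refine ⟨g1, fun v u hu h => g2 v u hu (h2 v u hu h), fun k' hk' l => ?_⟩
      rcases Nat.lt_succ_iff_lt_or_eq.1 hk' with h | h
      · exact keep g2 (h3 k' h l)
      · have : k' = ⟨k, hk⟩ := Fin.ext h
        rw [this]
        exact g4 l l.2
  · rintro τ ⟨h1, h2, h3⟩
    exact ⟨h1, h2, fun k l => h3 k k.2 l⟩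

/-- Copies the vector `c^j` to the last column of the table. -/
def loadVec (j : Fin s) : Prog (Reg s) (Arr s) :=
  forUp rTmp rV (.n j) (putEntry (rOff j) rV rN (rOff 0) (.indirect (.c j) rV))

theorem total_loadVec (hB : Bounds P.size D L B P.table) (j : Fin s) (hσ : Loading P σ) :
    Total B (P.size * 8 + 2) (loadVec j) σ fun τ =>
      Loading P τ ∧ Keeps P σ τ ∧ ∀ k, Done P (P.num ⟨j, k⟩) P.size τ := by
  have hlt := hB.lt
  have hj := P.n_le_size j
  refine Total.mono (Total.forUp (T := 5) (N := P.n j)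
    (fun k τ => Loading P τ ∧ Keeps P σ τ ∧ ∀ k' : Fin (P.n j), (k' : ℕ) < k →
      Done P (P.num ⟨j, k'⟩) P.size τ)
    (by simp) (by simp) (by simp) (by simp [putEntry, Prog.WritesIdx])
    (by simp [putEntry, Prog.WritesIdx]) (hσ.n j) (by omega) ⟨hσ, fun _ _ _ h => h, by simp⟩
    (fun k τ v h => ⟨h.1.setIdx (by simp) v, h.2⟩)
    (fun k τ v h => ⟨h.1.setIdx (by simp) v, h.2⟩) ?_)
    (show P.n j * (5 + 3) + 2 ≤ _ by gcongr) ?_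
  · rintro k τ hk hτ ⟨h1, h2, h3⟩
    have hk' := P.num_val j ⟨k, hk⟩
    have h0 : P.offset 0 = 0 := rfl
    refine (total_putEntry (v := P.num ⟨j, ⟨k, hk⟩⟩) (u := P.size) hB h1 (by simp) (by simp) ?_ ?_
      (Fin.is_lt _) le_rfl ?_).imp ?_
    · rw [h1.off j j.2.le, hτ, hk']
    · rw [h1.idx_N, h1.off 0 (Nat.zero_le _), h0, add_zero]
    · intro w
      simp only [State.get, Ref.name, Ref.pos, State.setIdx_arr, h1.arr _ (by simp : Arr.c j ≠ _)]
      rw [State.setIdx_idx, if_neg (by simp), hτ, table_size]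
      simp [input, hk, lin]
    · rintro ρ ⟨g1, g2, g3, -⟩
      refine ⟨g1, fun v u hu h => g2 v u hu (h2 v u hu h), fun k' hk' => ?_⟩
      rcases Nat.lt_succ_iff_lt_or_eq.1 hk' with h | h
      · exact g2 _ _ le_rfl (h3 k' h)
      · have : k' = ⟨k, hk⟩ := Fin.ext h
        rw [this]; exact g3
  · rintro τ ⟨h1, h2, h3⟩
    exact ⟨h1, h2, fun k => h3 k k.2⟩

/-- All pairs of blocks. -/
def pairs (s : ℕ) : List (Fin s × Fin s) := List.finRange s ×ˢ List.finRange s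

/-- Builds the table. -/
def load : Prog (Reg s) (Arr s) :=
  .seq (loadOffsets s) (.seq (.idxCopy rN (rOff s)) (.seq (.idxConst rTmp 1)
    (.seq (.idxArith .add rW rN rTmp)
    (.seq (seqList ((pairs s).map fun p => if p.1 < p.2 then loadBlock p.1 p.2 else .skip))
      (seqList ((List.finRange s).map loadVec))))))

/-- The running time of `load`. -/
def loadTime (s N : ℕ) : ℕ :=
  2 * s + 1 + (1 + (1 + (1 + ((pairs s).length * (N * (N * 15 + 5) + 2) + 1 +
    ((List.finRange s).length * (N * 8 + 2) + 1)))))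

theorem total_load (hB : Bounds P.size D L B P.table) :
    Total B (loadTime s P.size) load P.input fun τ =>
      Loading P τ ∧ Loaded P.size P.table τ := by
  have hlt := hB.lt
  refine Total.seq ((total_loadOffsets P (by omega) s le_rfl).imp ?_)
  rintro σ ⟨h1, h2, h3⟩
  have hN : σ.idx (rOff s) = P.size := (h1 s le_rfl).trans P.offset_self
  refine Total.seq (Total.idxCopy (by omega) (Total.seq (Total.idxConst (by omega)
    (Total.seq (Total.idxArith ?_ ?_)))))
  · simp [IdxOp.eval, hN]; omega
  have hfin : Loading P (((σ.setIdx rN (σ.idx (rOff s))).setIdx rTmp 1).setIdx rW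
      (IdxOp.add.eval (((σ.setIdx rN (σ.idx (rOff s))).setIdx rTmp 1).idx rN)
        (((σ.setIdx rN (σ.idx (rOff s))).setIdx rTmp 1).idx rTmp))) := by
    refine ⟨fun i hi => ?_, fun j => ?_, ?_, ?_, fun a _ => by simp [h3]⟩
    · simpa using h1 i hi
    · simpa using h2 j
    · simp [hN]
    · simp [hN, IdxOp.eval]
  have harr : (((σ.setIdx rN (σ.idx (rOff s))).setIdx rTmp 1).setIdx rW
      (IdxOp.add.eval (((σ.setIdx rN (σ.idx (rOff s))).setIdx rTmp 1).idx rN)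
        (((σ.setIdx rN (σ.idx (rOff s))).setIdx rTmp 1).idx rTmp))).arr = P.input.arr := h3
  generalize ((σ.setIdx rN (σ.idx (rOff s))).setIdx rTmp 1).setIdx rW _ = ρ at *
  -- The diagonal blocks vanish, and so do the cells of the table at the start.
  have hdiag : ∀ j k l, Done P (P.num ⟨j, k⟩) (P.num ⟨j, l⟩) ρ := by
    intro j k l
    simp [Done, harr, table_num, sym, upper, block, input]
  refine Total.seq ((Total.seqList_map (T := P.size * (P.size * 15 + 5) + 2) _
    (fun τ => Loading P τ ∧ Keeps P ρ τ)
    (fun p τ => p.1 < p.2 → ∀ k l, Done P (P.num ⟨p.1, k⟩) (P.num ⟨p.2, l⟩) τ ∧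
        Done P (P.num ⟨p.2, l⟩) (P.num ⟨p.1, k⟩) τ) (pairs s) ⟨hfin, fun _ _ _ h => h⟩ ?_).imp ?_)
  · rintro ⟨i, j⟩ τ - ⟨t1, t2⟩
    by_cases hij : i < j
    · simp only [hij, if_true, forall_true_left]
      refine (total_loadBlock hB hij t1).imp ?_
      rintro θ ⟨g1, g2, g3⟩
      exact ⟨⟨g1, fun v u hu h => g2 v u hu (t2 v u hu h)⟩, g3, fun y hy hy' k l =>
        ⟨g2 _ _ (Fin.is_lt _).le (hy hy' k l).1, g2 _ _ (Fin.is_lt _).le (hy hy' k l).2⟩⟩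
    · simp only [hij, if_false]
      exact (Total.skip ⟨⟨t1, t2⟩, fun h => absurd h id, fun _ h => h⟩).mono (by omega) fun _ h => h
  · rintro τ ⟨⟨t1, t2⟩, t3, -⟩
    refine (Total.seqList_map (T := P.size * 8 + 2) _
      (fun θ => Loading P θ ∧ Keeps P τ θ)
      (fun j θ => ∀ k, Done P (P.num ⟨j, k⟩) P.size θ) (List.finRange s)
      ⟨t1, fun _ _ _ h => h⟩ ?_).imp ?_
    · rintro j θ - ⟨g1, g2⟩
      refine (total_loadVec hB j g1).imp ?_
      rintro ζ ⟨z1, z2, z3⟩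
      exact ⟨⟨z1, fun v u hu h => z2 v u hu (g2 v u hu h)⟩, z3, fun y hy k => z2 _ _ le_rfl (hy k)⟩
    · rintro θ ⟨⟨g1, g2⟩, g3, -⟩
      refine ⟨g1, g1.idx_N, g1.idx_W, fun v hv u hu => ?_⟩
      obtain ⟨⟨i, k⟩, hp⟩ := P.num.surjective ⟨v, hv⟩
      have hp' : v = P.num ⟨i, k⟩ := (congrArg Fin.val hp).symm
      rcases hu.lt_or_eq with hu' | rfl
      · obtain ⟨⟨j, l⟩, hq⟩ := P.num.surjective ⟨u, hu'⟩
        have hq' : u = P.num ⟨j, l⟩ := (congrArg Fin.val hq).symm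
        refine g2 v u hu ?_
        rw [hp', hq']
        rcases lt_trichotomy i j with h | rfl | h
        · exact (t3 (i, j) (by simp [pairs]) h k l).1
        · exact t2 _ _ (Fin.is_lt _).le (hdiag i k l)
        · exact (t3 (j, i) (by simp [pairs]) h l k).2
      · rw [hp']; exact g3 i (by simp) k

/-- Copies the block `j` of the best solution to the output. -/
def store (j : Fin s) : Prog (Reg s) (Arr s) :=
  forUp rTmp rV (.n j) (.seq (.idxArith .add rTmp (rOff j) rV)
    (.ratCopy (.indirect (.x j) rV) (.indirect aBest rTmp)))

/-- The best solution is `x`, and the dimensions are known. -/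
structure Storing (P : QuadInstance s) (x : ℕ → ℚ) (σ : State (Reg s) (Arr s)) : Prop where
  off : ∀ i ≤ s, σ.idx (rOff i) = P.offset i
  n : ∀ j, σ.idx (.n j) = P.n j
  best : σ.arr aBest = x

theorem Storing.setIdx {x : ℕ → ℚ} (h : Storing P x σ) {i : Reg s} (hi : i = rTmp ∨ i = rV)
    (v : ℕ) : Storing P x (σ.setIdx i v) := by
  refine ⟨fun k hk => ?_, fun j => ?_, h.best⟩ <;> rcases hi with rfl | rfl
  · simpa using h.off k hk
  · simpa using h.off k hk
  · simpa using h.n j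
  · simpa using h.n j

theorem total_store (hB : Bounds P.size D L B P.table) {x : ℕ → ℚ}
    (hx : ∀ v < P.size, x v = 0 ∨ x v = 1) (j : Fin s) (hσ : Storing P x σ) :
    Total B (P.size * 5 + 2) (store j) σ fun τ =>
      Storing P x τ ∧ (∀ k : Fin (P.n j), τ.arr (.x j) k = x (P.num ⟨j, k⟩)) ∧
      ∀ i ≠ j, τ.arr (.x i) = σ.arr (.x i) := by
  have hlt := hB.lt
  have hj := P.n_le_size j
  refine Total.mono (Total.forUp (T := 2) (N := P.n j)
    (fun k τ => Storing P x τ ∧ (∀ k' : Fin (P.n j), (k' : ℕ) < k →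
      τ.arr (.x j) k' = x (P.num ⟨j, k'⟩)) ∧ ∀ i ≠ j, τ.arr (.x i) = σ.arr (.x i))
    (by simp) (by simp) (by simp) (by simp [Prog.WritesIdx]) (by simp [Prog.WritesIdx]) (hσ.n j)
    (by omega) ⟨hσ, by simp, fun _ _ => rfl⟩ (fun k τ v h => ⟨h.1.setIdx (by simp) v, h.2⟩)
    (fun k τ v h => ⟨h.1.setIdx (by simp) v, h.2⟩) ?_)
    (show P.n j * (2 + 3) + 2 ≤ _ by gcongr) ?_
  · rintro k τ hk hτ ⟨h1, h2, h3⟩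
    have hk' : (P.num ⟨j, ⟨k, hk⟩⟩ : ℕ) = P.offset j + k := P.num_val j ⟨k, hk⟩
    have hkN := Fin.is_lt (P.num ⟨j, ⟨k, hk⟩⟩)
    refine Total.mono (Total.seq (Total.idxArith ?_ (Total.ratCopy ?_ ⟨?_, ?_, ?_⟩)))
      (show 1 + 1 ≤ 2 by omega) fun _ h => h
    · simp only [IdxOp.eval, h1.off j j.2.le, hτ]; omega
    · simp only [State.get, Ref.name, Ref.pos, State.setIdx_idx, State.setIdx_arr, IdxOp.eval,
        if_true, h1.off j j.2.le, hτ, h1.best]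
      rw [← hk']
      rcases hx _ hkN with h | h <;> rw [h]
      · exact hB.ratSize_zero_le
      · exact hB.ratSize_one_le
    · have h4 := h1.setIdx (i := rTmp) (.inl rfl)
        (IdxOp.add.eval (τ.idx (rOff j)) (τ.idx rV))
      exact ⟨h4.off, h4.n, (State.set_arr_of_ne _ _ _ (by simp [Ref.name])).trans h4.best⟩
    · intro k' hk''
      simp only [State.set_arr, Ref.name, Ref.pos, true_and, State.get, State.setIdx_idx,
        State.setIdx_arr, IdxOp.eval, if_true, h1.off j j.2.le, hτ, h1.best,
        if_neg (show (rV : Reg s) ≠ rTmp by simp)]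
      split_ifs with h
      · have : k' = ⟨k, hk⟩ := Fin.ext h
        rw [this, hk']
      · exact h2 k' (by omega)
    · intro i hi
      rw [State.set_arr_of_ne _ _ _ (by simpa [Ref.name] using hi)]
      exact h3 i hi
  · rintro τ ⟨h1, h2, h3⟩
    exact ⟨h1, fun k => h2 k k.2, h3⟩

/-- Loads the table, searches for the best solution, and copies it to the output. -/
def solve (D : ℕ) : Prog (Reg s) (Arr s) :=
  .seq load (.seq (search D) (seqList ((List.finRange s).map store)))

theorem writesIdx_search (D : ℕ) {x : Reg s} (h : (search D).WritesIdx x) :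
    x ∈ itemRegs D ∨ x = rTmp ∨ x = rV ∨ x = rU := by
  rcases writesIdx_enum _ _ _ _ h with h | h | h
  · exact .inl h
  · exact .inr (.inl h)
  · exact .inr (writesIdx_tryItems D h)

/-- The running time of `solve`. -/
def solveTime (s D N : ℕ) : ℕ :=
  loadTime s N + (enumTime (N + 1) (tryTime N D) (itemRegs D : List (Reg s)).length +
    ((List.finRange s).length * (N * 5 + 2) + 1))

theorem total_solve (hB : Bounds P.size D L B P.table) (h0 : 0 < P.size)
    (hD : Module.finrank ℚ (colSpace P.size P.table) ≤ D + 1) :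
    Total B (solveTime s D P.size) (solve D) P.input fun τ => P.IsOptimal (P.output τ) := by
  refine Total.seq ((total_load hB).imp ?_)
  rintro σ ⟨h1, h2⟩
  have hbest : σ.arr aBest = fun _ => 0 := h1.arr _ (by simp)
  have hzero : ∀ x : ℕ → ℚ, (∀ v < P.size, x v = 0) → score P.size P.table x = 0 := by
    intro x hx
    refine Finset.sum_eq_zero fun v hv => Finset.sum_eq_zero fun u _ => ?_
    have hv' := Finset.mem_range.1 hv
    simp [extend, hv', hx v hv']
  have hval : σ.arr aVal 1 = 0 := congrFun (h1.arr aVal (by simp)) 1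
  have hσ : Searching P.size P.table σ :=
    { toLoaded := h2
      bit := fun v _ => .inl (by rw [hbest])
      val := by rw [hval, hbest, hzero _ fun _ _ => rfl] }
  refine Total.seq ((total_search hB hσ).frame.imp ?_)
  rintro ρ ⟨⟨g1, g2, g3⟩, f, -⟩
  have hf : ∀ x, x ∉ itemRegs D → x ≠ rTmp → x ≠ rV → x ≠ rU → ρ.idx x = σ.idx x := by
    intro x a b c d
    refine f x fun h => ?_
    have := writesIdx_search D h
    tauto
  have hst : Storing P (ρ.arr aBest) ρ := by
    refine ⟨fun i hi => (hf _ ?_ (by simp) (by simp) (by simp)).trans (h1.off i hi),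
      fun j => (hf _ ?_ (by simp) (by simp) (by simp)).trans (h1.n j), rfl⟩
    · intro h
      obtain ⟨i', -, q, -, h⟩ := mem_itemRegs.1 h
      simp only [Reg.work.injEq] at h
      omega
    · intro h
      obtain ⟨i', -, q, -, h⟩ := mem_itemRegs.1 h
      simp at h
  set b := ρ.arr aBest
  refine (Total.seqList_map (T := P.size * 5 + 2) store (Storing P b)
    (fun j τ => ∀ k : Fin (P.n j), τ.arr (.x j) k = b (P.num ⟨j, k⟩)) (List.finRange s) hst
    ?_).imp ?_
  · intro j τ _ hτ
    refine (total_store hB g1.bit j hτ).imp ?_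
    rintro θ ⟨t1, t2, t3⟩
    refine ⟨t1, t2, fun i hi => ?_⟩
    by_cases hij : i = j
    · subst hij; exact t2
    · rw [t3 i hij]; exact hi
  · rintro τ ⟨-, h4, -⟩
    have hout : P.output τ = fun j k => b (P.num ⟨j, k⟩) := by
      funext j k; exact h4 j (by simp) k
    -- The score is twice the objective value.
    have hobj : ∀ x : ℕ → ℚ, 2 * P.obj (fun j k => x (P.num ⟨j, k⟩)) = score P.size P.table x := by
      intro x
      have := P.two_mul_obj_eq_sum (extend P.size x) (by simp [extend])
      simpa [extend, score] using this
    have hge : ∀ x : ∀ j, Fin (P.n j) → ℚ, P.IsOptimal x → P.obj x ≤ P.obj (P.output τ) →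
        P.IsOptimal (P.output τ) := by
      intro x hx hle
      refine ⟨fun j k => ?_, fun y hy => (hx.2 y hy).trans hle⟩
      rw [hout]; exact g1.bit _ (Fin.is_lt _)
    obtain ⟨x, hx, hx'⟩ := P.exists_optimal_pattern h0 hD
    refine hge x hx ?_
    have hb := hobj b
    rw [← hout, ← g1.val] at hb
    rcases hx' with hx' | ⟨its, hits, hx'⟩
    · have h5 := hobj fun _ => 0
      rw [hzero _ fun _ _ => rfl] at h5
      have : x = fun j k => 0 := by funext j k; exact hx' j k
      rw [this]
      linarith
    · have h5 := hobj (pattern P.size P.table D its)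
      have : x = fun j k => pattern P.size P.table D its (P.num ⟨j, k⟩) := by
        funext j k; exact hx' j k
      rw [this]
      linarith [g3 its hits]

end

/-! ### Polynomial bounds -/

theorem eval_mono (T : Polynomial ℕ) {a b : ℕ} (h : a ≤ b) : T.eval a ≤ T.eval b := by
  simp only [Polynomial.eval_eq_sum, Polynomial.sum]
  exact Finset.sum_le_sum fun i _ => Nat.mul_le_mul_left _ (Nat.pow_le_pow_left h i)

open Polynomial in
theorem exists_enumTime_eq (T : Polynomial ℕ) (k : ℕ) :
    ∃ T' : Polynomial ℕ, ∀ N, T'.eval N = enumTime (N + 1) (T.eval N) k := by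
  induction k with
  | zero => exact ⟨T, fun N => rfl⟩
  | succ k ih =>
    obtain ⟨T', h⟩ := ih
    exact ⟨(X + 1) * (T' + 3) + 2, fun N => by simp [enumTime, h]⟩

open Polynomial in
theorem exists_solveTime_eq (s D : ℕ) : ∃ T : Polynomial ℕ, ∀ N, T.eval N = solveTime s D N := by
  obtain ⟨T, hT⟩ := exists_enumTime_eq
    (X * C (rowTime D + 3) + 3 + (X * ((X + 1) * 8 + 5) + 3 + (X * 4 + 4)))
    (itemRegs D : List (Reg s)).length
  refine ⟨C (2 * s + 1) + (1 + (1 + (1 + (C (pairs s).length * (X * (X * 15 + 5) + 2) + 1 +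
    (C (List.finRange s).length * (X * 8 + 2) + 1))))) +
    (T + (C (List.finRange s).length * (X * 5 + 2) + 1)), fun N => ?_⟩
  simp only [solveTime, loadTime, eval_add, eval_mul, eval_C, eval_X, eval_one, eval_ofNat, hT,
    tryTime]

end QuadInstance

open Polynomial in
theorem mainTheorem2 (s : ℕ) (hs : 0 < s) (r : ℕ) :
    ∃ (p : RatRAM.Prog (QuadInstance.Reg s) (QuadInstance.Arr s)) (T S : Polynomial ℕ),
      ∀ P : QuadInstance s, (∀ (i j : Fin s) (h : i < j), (P.Q i j h).rank ≤ r) →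
        ∃ (t : ℕ) (τ : RatRAM.State (QuadInstance.Reg s) (QuadInstance.Arr s)),
          RatRAM.Exec (S.eval P.bitSize) p P.input t τ ∧
          t ≤ T.eval P.dim ∧
          P.IsOptimal (P.output τ) := by
  obtain ⟨T, hT⟩ := QuadInstance.exists_solveTime_eq s (2 * (s * s * r))
  set D := 2 * (s * s * r)
  refine ⟨QuadInstance.solve D, T,
    (2 * (C (4 ^ D) * X) + 3) + (2 * (X * (X + 1) * (X + 4)) + 3) + ((X + 1) * (X + 1) + 7),
    fun P hr => ?_⟩
  have h1 : P.size ≤ P.dim := P.size_le_dim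
  have h2 : P.size ≤ P.bitSize := h1.trans P.dim_le_bitSize
  have h0 : 0 < P.size := (P.n_pos ⟨0, hs⟩).trans_le (P.n_le_size _)
  obtain ⟨t, τ, h3, h4, h5⟩ := QuadInstance.total_solve (P := P) (D := D) (L := P.bitSize)
    (B := (2 * (4 ^ D * P.bitSize) + 3) + (2 * (P.bitSize * (P.bitSize + 1) * (P.bitSize + 4)) + 3)
      + ((P.bitSize + 1) * (P.bitSize + 1) + 7))
    { height := P.heightLe_table
      elim_le := by omega
      sum_le := by
        have : P.size * (P.size + 1) * (P.bitSize + 4) ≤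
          P.bitSize * (P.bitSize + 1) * (P.bitSize + 4) := by gcongr
        omega
      idx_le := by
        have : (P.size + 1) * (P.size + 1) ≤ (P.bitSize + 1) * (P.bitSize + 1) := by gcongr
        omega } h0 (P.finrank_colSpace_le hr)
  refine ⟨t, τ, ?_, h4.trans ?_, h5⟩
  · simpa using h3
  · rw [← hT]; exact QuadInstance.eval_mono T h1
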